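/- **Setting.** Let $\mathcal H=(\mathbb C^d)^{\otimes n}$ with $d\ge 1$, write $\langle\!\langle A|B\rangle\!\rangle=\operatorname{tr}(A^\dagger B)$ and $\|A\|_{HS}^2=\operatorname{tr}(A^\dagger A)$. Let $G$ be a compact (or finite) group, $D\ge 1$, $U_1,\dots,U_D$ continuous unitary representations of $G$ on $\mathcal H$, and $W_1,\dots,W_D$ fixed unitaries on $\mathcal H$; for $\boldsymbol g\in G^D$ put $C(\boldsymbol g)=U_1(g_1)W_1\cdots U_D(g_D)W_D$. For each $i$ fix an irreducible tensor operator basis $\{T^{(i)}_{\lambda,k}\}$ for $U_i$: an operator basis, orthonormal for $\langle\!\langle\cdot|\cdot\rangle\!\rangle$, with $U_i(g)T^{(i)}_{\lambda,k}U_i(g)^\dagger=\sum_{k'}v^{\lambda}_{k'k}(g)T^{(i)}_{\lambda,k'}$, where each $v^\lambda$ is an irreducible matrix representation of $G$ and $\lambda$ includes a multiplicity label. Let $d_{max}$ be the maximal dimension of these irreducible representations. Let $\Pi^{(i)}_0$ be the projector onto the span of the basis operators of layer $i$ whose irreducible representation is trivial, and let $\mathbf W_i X=W_iXW_i^\dagger$.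 "Node at layer $i$" means a basis operator of layer $i$. **Noise.** After each layer $U_i(g_i)W_i$ a quantum channel $\mathcal E_i$ acts, so that the noisy expectation value of an observable $O=O^\dagger$ is $\tilde o(\boldsymbol g)=\operatorname{tr}\big(O\,\mathcal E_1\mathcal U_1\mathbf W_1\cdots\mathcal E_D\mathcal U_D\mathbf W_D(|0^n\rangle\langle 0^n|)\big)$ with $\mathcal U_iX=U_i(g_i)XU_i(g_i)^\dagger$. Assume that the noise is diagonal, $\mathcal E_i T^{(i)}_{\lambda,k}=e^{(i)}_{\lambda,k}T^{(i)}_{\lambda,k}$, with $e^{(i)}_{\lambda,k}=1$ if $\lambda$ is trivial and $|e^{(i)}_{\lambda,k}|\le 1-\gamma$ otherwise, where $\gamma\ge 0$. **Controlled tree growth.** Assume that (a) for every $i<D$ and every node $T$ at layer $i$, the operator $W_i^\dagger T W_i$ lies entirely in the range of $\Pi_0^{(i+1)}$ or is orthogonal to it; and (b) every contraction has at most $s$ terms. Here the contraction of a node $T$ at layer $i$ has one term for each node $T'$ at a layer $j>i$ with a non-trivial irreducible representation and $\langle\!\langle T|\mathbf W_i\Pi_0^{(i+1)}\mathbf W_{i+1}\Pi_0^{(i+2)}\cdots\Pi_0^{(j-1)}\mathbf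 W_{j-1}|T'\rangle\!\rangle\ne 0$, and one more term if the functional $\langle\!\langle T|\mathbf W_i\Pi_0^{(i+1)}\cdots\Pi_0^{(D)}\mathbf W_D$ is non-zero. **Truncation.** A path consists of a label $\lambda_i$ and two components $k_i,k_i'$ of it for each layer $i$, and contributes $$\operatorname{tr}\big(O\,T^{(1)}_{\lambda_1,k_1}\big)\prod_{i=1}^{D}e^{(i)}_{\lambda_i,k_i}\,v^{\lambda_i}_{k_ik_i'}(g_i)\,\langle\!\langle T^{(i)}_{\lambda_i,k_i'}|\mathbf W_i|T^{(i+1)}_{\lambda_{i+1},k_{i+1}}\rangle\!\rangle ,$$ where the last ket ($i=D$) stands for $|0^n\rangle\langle0^n|$. For $L\in\mathbb N$ let $\tilde o^{\mathcal T}(\boldsymbol g)$ be the sum of the contributions of the paths for which at most $L$ of the $\lambda_i$ are non-trivial. Let $r(O)$ be the number of basis operators $T$ of layer 1 with $\operatorname{tr}(T^\dagger O)\ne 0$. **Machine.** Consider random access machines with natural-number and complex memory (unit cost for arithmetic, memory access and tests) that access the instance through subroutines which: list the basis operators in the expansion of $O$ with their coefficients, and give the dimension and the triviality of a block (unit cost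 per call); give the $q$-th term of the contraction of a node, with its value (cost $cost(\mathtt{contract})\ge1$); give a noisy matrix coefficient $e^{(i)}_{\lambda,k}v^\lambda_{kk'}(g_i)$ (cost $cost(\mathtt{matrix\text{-}coeff})\ge1$); give the overlap $\langle\!\langle T|\mathbf W_i\Pi_0^{(i+1)}\cdots\Pi_0^{(D)}\mathbf W_D|0^n\rangle\langle 0^n|\rangle\!\rangle$ of a node (cost $cost(\mathtt{overlap})\ge1$). The cost of evaluating one path is $cost(\mathtt{evaluate})=L\,(cost(\mathtt{contract})+cost(\mathtt{matrix\text{-}coeff}))+cost(\mathtt{overlap})$. **Theorem.** There are a single program $\mathcal A$ and a universal constant $K$ such that, in every such situation and for every $L\in\mathbb N$, $$\|\tilde o-\tilde o^{\mathcal T}\|_{L^2(G^D)}\le e^{-\gamma L}\,\|O\|_{HS},$$ the $L^2$ norm being taken with respect to normalised Haar measure, and, for every $\boldsymbol g\in G^D$, on input $L$ the program $\mathcal A$ halts with output $\tilde o^{\mathcal T}(\boldsymbol g)$ after at most $K\big(r(O)\,(s\,d_{max})^L\,cost(\mathtt{evaluate})+1\big)$ steps. -/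

import Mathlib

open MeasureTheory
open scoped Matrix

noncomputable section

namespace GroupCircuit

/-! ### Operators on `n` qudits -/

/-- Computational basis labels of `n` qudits of local dimension `d`. -/
abbrev Config (n d : ℕ) : Type := Fin n → Fin d

/-- Operators on the Hilbert space `(ℂ^d)^{⊗ n}`. -/
abbrev QOp (n d : ℕ) : Type := Matrix (Config n d) (Config n d) ℂ

/-- The Hilbert-Schmidt inner product `⟨⟨A|B⟩⟩ = tr(A† B)`. -/
def hsInner {n d : ℕ} (A B : QOp n d) : ℂ := (Aᴴ * B).trace

/-- The Hilbert-Schmidt norm. -/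
def hsNorm {n d : ℕ} (A : QOp n d) : ℝ := Real.sqrt (hsInner A A).re

/-- The input state `|0^n⟩⟨0^n|`. -/
def zeroState (n d : ℕ) [NeZero d] : QOp n d := Matrix.single (fun _ => 0) (fun _ => 0) 1

/-- Quantum channels (completely positive and trace preserving maps), in Kraus form. -/
def IsQuantumChannel {n d : ℕ} (E : QOp n d →ₗ[ℂ] QOp n d) : Prop :=
  ∃ (m : ℕ) (K : Fin m → QOp n d),
    ∑ j, (K j)ᴴ * K j = 1 ∧ ∀ X, E X = ∑ j, K j * X * (K j)ᴴ

/-! ### Irreducible tensor operator bases -/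

/-- An irreducible tensor operator (ITO) basis for the unitary representation `U`: a Hilbert-Schmidt
orthonormal operator basis that consists of blocks, each of which transforms under conjugation by
`U` according to an irreducible representation. A block stands for an irreducible representation
together with a multiplicity label. -/
structure ITOBasis {G : Type*} [Group G] {n d : ℕ}
    (U : G →* Matrix.unitaryGroup (Config n d) ℂ) where
  /-- the number of blocks -/
  numBlocks : ℕ
  /-- the dimension of the irreducible representation of a block -/
  dim : Fin numBlocks → ℕ
  /-- the irreducible representation of a block -/
  irrep : (β : Fin numBlocks) → Representation ℂ G (Fin (dim β) → ℂ)
  irreducible : ∀ β, (irrep β).IsIrreducible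
  /-- the basis operators -/
  T : (β : Fin numBlocks) → Fin (dim β) → QOp n d
  orthonormal : ∀ (β : Fin numBlocks) (k : Fin (dim β)) (β' : Fin numBlocks) (k' : Fin (dim β')),
    hsInner (T β k) (T β' k') =
      if (⟨β, k⟩ : (β : Fin numBlocks) × Fin (dim β)) = ⟨β', k'⟩ then 1 else 0
  complete : Submodule.span ℂ {X | ∃ β k, X = T β k} = ⊤
  covariant : ∀ (β : Fin numBlocks) (k : Fin (dim β)) (g : G),
    (U g : QOp n d) * T β k * (U g : QOp n d)ᴴ =
      ∑ k', LinearMap.toMatrix' (irrep β g) k' k • T β k'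

namespace ITOBasis

variable {G : Type*} [Group G] {n d : ℕ} {U : G →* Matrix.unitaryGroup (Config n d) ℂ}

/-- Labels `(λ, k)` of the basis operators. -/
abbrev Label (B : ITOBasis U) : Type := (β : Fin B.numBlocks) × Fin (B.dim β)

/-- The basis operator with a given label. -/
def op (B : ITOBasis U) (a : B.Label) : QOp n d := B.T a.1 a.2

/-- The matrix coefficients `v^λ_{k k'}(g)`. -/
def coeff (B : ITOBasis U) (β : Fin B.numBlocks) (g : G) (k k' : Fin (B.dim β)) : ℂ :=
  LinearMap.toMatrix' (B.irrep β g) k k'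

/-- The block carries the trivial irreducible representation. -/
def Trivial (B : ITOBasis U) (β : Fin B.numBlocks) : Prop := (B.irrep β).IsTrivial

open Classical in
/-- The projector `Π₀` onto the span of the basis operators that transform trivially. -/
def projTrivial (B : ITOBasis U) (X : QOp n d) : QOp n d :=
  ∑ a : B.Label, if B.Trivial a.1 then hsInner (B.op a) X • B.op a else 0

open Classical in
/-- The labels of the basis operators that occur in the expansion of `O`. -/
def support (B : ITOBasis U) (O : QOp n d) : Finset B.Label :=
  Finset.univ.filter fun a => hsInner (B.op a) O ≠ 0

/-- The rank `r(O)` of `O` with respect to the basis. -/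
def rank (B : ITOBasis U) (O : QOp n d) : ℕ := (B.support O).card

end ITOBasis

/-! ### Noisy group-parametrised circuits -/

/-- The data of a noisy group-parametrised circuit ensemble `U₁(g₁) W₁ ⋯ U_D(g_D) W_D`, with a noise
channel after each layer and an ITO basis for each of the representations `U_i`. -/
structure Ensemble (G : Type*) [Group G] [TopologicalSpace G] (n d D : ℕ) where
  /-- the representations -/
  U : Fin D → G →* Matrix.unitaryGroup (Config n d) ℂ
  continuous_U : ∀ i, Continuous fun g => (U i g : QOp n d)
  /-- the fixed unitaries -/
  W : Fin D → Matrix.unitaryGroup (Config n d) ℂ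
  /-- the noise -/
  E : Fin D → (QOp n d →ₗ[ℂ] QOp n d)
  channel : ∀ i, IsQuantumChannel (E i)
  /-- the operator bases -/
  B : (i : Fin D) → ITOBasis (U i)

namespace Ensemble

variable {G : Type*} [Group G] [TopologicalSpace G] {n d D : ℕ}

/-- The state obtained from `|0^n⟩` by the noisy circuit: the layers `D, …, 1` are applied in this
order, and a layer is `W_i`, then `U_i(g_i)`, then the noise. -/
def noisyState [NeZero d] (C : Ensemble G n d D) (g : Fin D → G) : QOp n d :=
  (List.finRange D).foldr
    (fun i ρ => C.E i (((C.U i (g i) : QOp n d) * (C.W i : QOp n d)) * ρ *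
      ((C.U i (g i) : QOp n d) * (C.W i : QOp n d))ᴴ))
    (zeroState n d)

/-- The noisy expectation value `õ(g)`. -/
def noisyMean [NeZero d] (C : Ensemble G n d D) (O : QOp n d) (g : Fin D → G) : ℂ :=
  (O * C.noisyState g).trace

/-- The noise eigenvalue `e_{λ,k}` at layer `i`. -/
def noiseEigenvalue (C : Ensemble G n d D) (i : Fin D) (a : (C.B i).Label) : ℂ :=
  hsInner ((C.B i).op a) (C.E i ((C.B i).op a))

/-- The noise is diagonal in the ITO bases, acts as the identity on the operators that transform
trivially, and has spectral gap (at least) `γ` on all others. -/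
structure NoisePenalised (C : Ensemble G n d D) (γ : ℝ) : Prop where
  gap_nonneg : 0 ≤ γ
  diagonal : ∀ i a, C.E i ((C.B i).op a) = C.noiseEigenvalue i a • (C.B i).op a
  fixes_trivial : ∀ i (a : (C.B i).Label), (C.B i).Trivial a.1 → C.noiseEigenvalue i a = 1
  gap : ∀ i (a : (C.B i).Label), ¬ (C.B i).Trivial a.1 → ‖C.noiseEigenvalue i a‖ ≤ 1 - γ

/-! ### The path expansion and its truncation -/

/-- A path of basis operators: at each layer an irreducible block together with the component
with which the path enters the layer and the component with which it leaves it. -/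
abbrev Path (C : Ensemble G n d D) : Type :=
  (i : Fin D) → (β : Fin (C.B i).numBlocks) × Fin ((C.B i).dim β) × Fin ((C.B i).dim β)

/-- The basis operator with which a path enters layer `m`; past the last layer, the input state. -/
def pathKet [NeZero d] (C : Ensemble G n d D) (p : C.Path) (m : ℕ) : QOp n d :=
  if h : m < D then (C.B ⟨m, h⟩).T (p ⟨m, h⟩).1 (p ⟨m, h⟩).2.1 else zeroState n d

/-- The contribution of a path to the noisy expectation value: the coefficient of the observable,
and for each layer a noise eigenvalue, a matrix coefficient of the irreducible representation
and a transfer coefficient of the fixed unitary. -/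
def pathWeight [NeZero d] (C : Ensemble G n d D) (O : QOp n d) (p : C.Path) (g : Fin D → G) : ℂ :=
  (O * C.pathKet p 0).trace *
    ∏ i : Fin D,
      (C.noiseEigenvalue i ⟨(p i).1, (p i).2.1⟩ *
        (C.B i).coeff (p i).1 (g i) (p i).2.1 (p i).2.2 *
        hsInner ((C.B i).T (p i).1 (p i).2.2)
          ((C.W i : QOp n d) * C.pathKet p (i + 1) * (C.W i : QOp n d)ᴴ))

open Classical in
/-- The number of non-trivial irreducible representations along a path. -/
def pathDegree (C : Ensemble G n d D) (p : C.Path) : ℕ :=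
  (Finset.univ.filter fun i => ¬ (C.B i).Trivial (p i).1).card

/-- The truncated noisy expectation value: the sum of the contributions of all the paths with at
most `L` non-trivial irreducible representations. -/
def truncatedMean [NeZero d] (C : Ensemble G n d D) (O : QOp n d) (L : ℕ) (g : Fin D → G) : ℂ :=
  ∑ p : C.Path, if C.pathDegree p ≤ L then C.pathWeight O p g else 0

/-! ### Contractions through the trivial subspaces -/

/-- Conjugation by the fixed unitary of layer `m` (if there is such a layer). -/
def hop (C : Ensemble G n d D) (m : ℕ) (X : QOp n d) : QOp n d :=
  if h : m < D then (C.W ⟨m, h⟩ : QOp n d) * X * (C.W ⟨m, h⟩ : QOp n d)ᴴ else X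

/-- The projector onto the trivial subspace of layer `m` (if there is such a layer). -/
def proj (C : Ensemble G n d D) (m : ℕ) (X : QOp n d) : QOp n d :=
  if h : m < D then (C.B ⟨m, h⟩).projTrivial X else X

/-- The superoperator `𝐖_i Π₀ 𝐖_{i+1} Π₀ ⋯ Π₀ 𝐖_{i+m}`. -/
def segment (C : Ensemble G n d D) : ℕ → ℕ → QOp n d → QOp n d
  | i, 0, X => C.hop i X
  | i, m + 1, X => C.hop i (C.proj (i + 1) (C.segment (i + 1) m X))

/-- The nodes of the path trees: a layer and a basis operator of that layer. -/
abbrev Node (C : Ensemble G n d D) : Type := (i : Fin D) × (C.B i).Label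

/-- The contraction `⟨⟨T_x| 𝐖_i Π₀ 𝐖_{i+1} Π₀ ⋯ Π₀ 𝐖_{j-1} |T_y⟩⟩` of a node `x` at layer `i`, which
goes through trivial subspaces only, to a node `y` at a later layer `j`. -/
def contraction (C : Ensemble G n d D) (x y : C.Node) : ℂ :=
  hsInner ((C.B x.1).op x.2) (C.segment x.1 (y.1 - x.1 - 1) ((C.B y.1).op y.2))

/-- The contraction `⟨⟨T_x| 𝐖_i Π₀ 𝐖_{i+1} Π₀ ⋯ Π₀ 𝐖_D |X⟩⟩` of a node to the end of the circuit. -/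
def endContraction (C : Ensemble G n d D) (x : C.Node) (X : QOp n d) : ℂ :=
  hsInner ((C.B x.1).op x.2) (C.segment x.1 (D - 1 - x.1) X)

open Classical in
/-- The non-trivial nodes that a node reaches by a non-zero contraction. -/
def exits (C : Ensemble G n d D) (x : C.Node) : Finset C.Node :=
  Finset.univ.filter fun y => x.1 < y.1 ∧ ¬ (C.B y.1).Trivial y.2.1 ∧ C.contraction x y ≠ 0

/-- The node reaches the end of the circuit by a non-zero contraction. -/
def Survives (C : Ensemble G n d D) (x : C.Node) : Prop := ∃ X, C.endContraction x X ≠ 0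

open Classical in
/-- The number of terms that the contraction of a node consists of: the basis operators on which
the next non-trivial representation acts, and one term for the end of the circuit. -/
def contractionRank (C : Ensemble G n d D) (x : C.Node) : ℕ :=
  (C.exits x).card + if C.Survives x then 1 else 0

/-- Controlled tree growth, in the Heisenberg picture: a fixed unitary maps a basis operator entirely
into the trivial subspace of the next layer or entirely into its orthogonal complement, and
contractions of basis operators through trivial subspaces consist of at most `s` terms. -/
structure ControlledGrowth (C : Ensemble G n d D) (s : ℕ) : Prop where
  all_or_nothing : ∀ (i j : Fin D), (j : ℕ) = i + 1 → ∀ a : (C.B i).Label,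
    (C.B j).projTrivial ((C.W i : QOp n d)ᴴ * (C.B i).op a * (C.W i : QOp n d)) = 0 ∨
    (C.B j).projTrivial ((C.W i : QOp n d)ᴴ * (C.B i).op a * (C.W i : QOp n d)) =
      (C.W i : QOp n d)ᴴ * (C.B i).op a * (C.W i : QOp n d)
  rank_le : ∀ x : C.Node, C.contractionRank x ≤ s

end Ensemble

/-! ### Random access machines with subroutines -/

/-- Names of the subroutines that a program can call. -/
inductive Sub
  | root
  | trivial
  | dim
  | contract
  | matrixCoeff
  | overlap

/-- Values of subroutines: four natural numbers take four natural numbers and a complex number. -/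
abbrev SubTable : Type := Sub → ℕ → ℕ → ℕ → ℕ → (Fin 4 → ℕ) × ℂ

/-- Programs of a random access machine with a memory of natural numbers and a memory of complex
numbers, both with indirect addressing. A `call f a r c` passes the natural numbers in the cells
`a, …, a + 3` to the subroutine `f`, and writes the answer to the cells `r, …, r + 3` and to the
complex cell `c`. -/
inductive Program
  | const (r v : ℕ)
  | add (r a b : ℕ)
  | sub (r a b : ℕ)
  | load (r a : ℕ)
  | store (a b : ℕ)
  | cconst (r v : ℕ)
  | cadd (r a b : ℕ)
  | cmul (r a b : ℕ)
  | cload (r a : ℕ)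
  | cstore (a b : ℕ)
  | call (f : Sub) (a r c : ℕ)
  | seq (p q : Program)
  | ifNonzero (r : ℕ) (p q : Program)
  | whileNonzero (r : ℕ) (p : Program)

/-- Machine states. -/
structure State where
  /-- the memory cells for natural numbers -/
  nat : ℕ → ℕ
  /-- the memory cells for complex numbers -/
  cpx : ℕ → ℂ

namespace State

/-- Write a natural number. -/
def setN (σ : State) (r v : ℕ) : State := ⟨Function.update σ.nat r v, σ.cpx⟩

/-- Write a complex number. -/
def setC (σ : State) (r : ℕ) (z : ℂ) : State := ⟨σ.nat, Function.update σ.cpx r z⟩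

/-- Write the answer of a subroutine. -/
def answer (σ : State) (r c : ℕ) (w : (Fin 4 → ℕ) × ℂ) : State :=
  ((((σ.setN r (w.1 0)).setN (r + 1) (w.1 1)).setN (r + 2) (w.1 2)).setN (r + 3) (w.1 3)).setC c w.2

/-- The initial state with input `L`. -/
def init (L : ℕ) : State := ⟨fun r => if r = 0 then L else 0, fun _ => 0⟩

end State

/-- `Runs val cost p σ τ t`: from the state `σ` the program `p` halts in the state `τ` after time `t`.
An instruction or a test takes one unit of time, a call of a subroutine takes its cost. -/
inductive Runs (val : SubTable) (cost : Sub → ℕ) : Program → State → State → ℕ → Prop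
  | const (σ : State) (r v : ℕ) : Runs val cost (.const r v) σ (σ.setN r v) 1
  | add (σ : State) (r a b : ℕ) :
      Runs val cost (.add r a b) σ (σ.setN r (σ.nat a + σ.nat b)) 1
  | sub (σ : State) (r a b : ℕ) :
      Runs val cost (.sub r a b) σ (σ.setN r (σ.nat a - σ.nat b)) 1
  | load (σ : State) (r a : ℕ) : Runs val cost (.load r a) σ (σ.setN r (σ.nat (σ.nat a))) 1
  | store (σ : State) (a b : ℕ) : Runs val cost (.store a b) σ (σ.setN (σ.nat a) (σ.nat b)) 1
  | cconst (σ : State) (r v : ℕ) : Runs val cost (.cconst r v) σ (σ.setC r (v : ℂ)) 1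
  | cadd (σ : State) (r a b : ℕ) :
      Runs val cost (.cadd r a b) σ (σ.setC r (σ.cpx a + σ.cpx b)) 1
  | cmul (σ : State) (r a b : ℕ) :
      Runs val cost (.cmul r a b) σ (σ.setC r (σ.cpx a * σ.cpx b)) 1
  | cload (σ : State) (r a : ℕ) : Runs val cost (.cload r a) σ (σ.setC r (σ.cpx (σ.nat a))) 1
  | cstore (σ : State) (a b : ℕ) : Runs val cost (.cstore a b) σ (σ.setC (σ.nat a) (σ.cpx b)) 1
  | call (σ : State) (f : Sub) (a r c : ℕ) :
      Runs val cost (.call f a r c) σ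
        (σ.answer r c (val f (σ.nat a) (σ.nat (a + 1)) (σ.nat (a + 2)) (σ.nat (a + 3)))) (cost f)
  | seq {p q : Program} {σ τ υ : State} {t u : ℕ} (hp : Runs val cost p σ τ t)
      (hq : Runs val cost q τ υ u) : Runs val cost (.seq p q) σ υ (t + u)
  | ifTrue {r : ℕ} {p q : Program} {σ τ : State} {t : ℕ} (h : σ.nat r ≠ 0)
      (hp : Runs val cost p σ τ t) : Runs val cost (.ifNonzero r p q) σ τ (t + 1)
  | ifFalse {r : ℕ} {p q : Program} {σ τ : State} {t : ℕ} (h : σ.nat r = 0)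
      (hq : Runs val cost q σ τ t) : Runs val cost (.ifNonzero r p q) σ τ (t + 1)
  | whileStop {r : ℕ} {p : Program} {σ : State} (h : σ.nat r = 0) :
      Runs val cost (.whileNonzero r p) σ σ 1
  | whileStep {r : ℕ} {p : Program} {σ τ υ : State} {t u : ℕ} (h : σ.nat r ≠ 0)
      (hp : Runs val cost p σ τ t) (hw : Runs val cost (.whileNonzero r p) τ υ u) :
      Runs val cost (.whileNonzero r p) σ υ (t + u + 1)

/-- The costs of the three subroutines of the path evaluation. All other subroutines only read the
input and take one unit of time per call. -/
structure Costs where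
  /-- the cost of one term of a contraction -/
  contract : ℕ
  /-- the cost of one (noisy) matrix coefficient -/
  matrixCoeff : ℕ
  /-- the cost of one overlap with the input state -/
  overlap : ℕ
  contract_pos : 0 < contract
  matrixCoeff_pos : 0 < matrixCoeff
  overlap_pos : 0 < overlap

namespace Costs

/-- The cost of a call. -/
def ofSub (c : Costs) : Sub → ℕ
  | .contract => c.contract
  | .matrixCoeff => c.matrixCoeff
  | .overlap => c.overlap
  | .root => 1
  | .trivial => 1
  | .dim => 1

/-- The cost of the evaluation of one path of a tree of height `L`: at most `L` contractions, at most
`L` matrix coefficients, and the overlap with the input state. -/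
def evaluate (c : Costs) (L : ℕ) : ℕ := L * (c.contract + c.matrixCoeff) + c.overlap

end Costs

namespace Ensemble

variable {G : Type*} [Group G] [TopologicalSpace G] {n d D : ℕ}

/-- The layer with a given number. -/
def layer? (_ : Ensemble G n d D) (i : ℕ) : Option (Fin D) :=
  if h : i < D then some ⟨i, h⟩ else none

/-- The block with a given number. -/
def block? (C : Ensemble G n d D) (i β : ℕ) : Option ((i : Fin D) × Fin (C.B i).numBlocks) :=
  (C.layer? i).bind fun i => if h : β < (C.B i).numBlocks then some ⟨i, β, h⟩ else none

/-- The node with a given triple of numbers. -/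
def node? (C : Ensemble G n d D) (i β k : ℕ) : Option C.Node :=
  (C.block? i β).bind fun b =>
    if h : k < (C.B b.1).dim b.2 then some ⟨b.1, b.2, k, h⟩ else none

/-- The terms of the contraction of a node `x`, in some order: `some y` stands for the node `y`, and
`none` for the end of the circuit. -/
def terms (C : Ensemble G n d D) (x : C.Node) : List (Option C.Node) :=
  open Classical in
  (C.exits x).toList.map some ++ if C.Survives x then [none] else []

open Classical in
/-- The values of the subroutines on an instance.

* `root q`: the `q`-th basis operator `(β, k)` in the expansion of the observable `O`, as `(1, β, k)`,
  and its coefficient; the first number is `0` if there is none.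
* `trivial i β`: whether block `β` of layer `i` is trivial, as `1` or `0`.
* `dim i β`: the dimension of block `β` of layer `i`.
* `contract i β k q`: the `q`-th term of the contraction of the node `(i, β, k)`, which is either a
  node `(j, β', k')`, given as `(1, j, β', k')` together with the value of the contraction, or the
  end of the circuit, given as `(2, 0, 0, 0)`; the first number is `0` if there is none.
* `matrixCoeff i β k k'`: the matrix coefficient `v^β_{k k'}(g_i)` multiplied by the noise eigenvalue.
* `overlap i β k`: the contraction of the node `(i, β, k)` with the input state. -/
def subroutines [NeZero d] [NeZero D] (C : Ensemble G n d D) (O : QOp n d) (g : Fin D → G) : SubTable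
  | .root, q, _, _, _ =>
      match ((C.B 0).support O).toList[q]? with
      | some a => (![1, a.1, a.2, 0], (O * (C.B 0).op a).trace)
      | none => (0, 0)
  | .trivial, i, β, _, _ =>
      match C.block? i β with
      | some b => (![if (C.B b.1).Trivial b.2 then 1 else 0, 0, 0, 0], 0)
      | none => (0, 0)
  | .dim, i, β, _, _ =>
      match C.block? i β with
      | some b => (![(C.B b.1).dim b.2, 0, 0, 0], 0)
      | none => (0, 0)
  | .contract, i, β, k, q =>
      match C.node? i β k with
      | some x =>
          match (C.terms x)[q]? with
          | some (some y) => (![1, y.1, y.2.1, y.2.2], C.contraction x y)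
          | some none => (![2, 0, 0, 0], 0)
          | none => (0, 0)
      | none => (0, 0)
  | .matrixCoeff, i, β, k, k' =>
      match C.node? i β k with
      | some x =>
          if h : k' < (C.B x.1).dim x.2.1 then
            (0, C.noiseEigenvalue x.1 x.2 * (C.B x.1).coeff x.2.1 (g x.1) x.2.2 ⟨k', h⟩)
          else (0, 0)
      | none => (0, 0)
  | .overlap, i, β, k, _ =>
      match C.node? i β k with
      | some x => (0, C.endContraction x (zeroState n d))
      | none => (0, 0)

end Ensemble

end GroupCircuit

end

/-! Accuracy. Expanding in the tensor operator basis after every layer turns the noisy mean into the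
sum of all path weights, so the truncation error is the sum over the paths with more than `L`
non-trivial layers. Paths are grouped by their pattern, the set of layers at which they are
non-trivial. If two patterns differ, then at some layer one path has a constant matrix coefficient
and the other a coefficient of a non-trivial irreducible representation, whose Haar integral
vanishes (`integral_coeff`). Thus different groups are orthogonal in L², full Schur orthogonality is
not needed, and the squared error is the integral of the sum over patterns S of |F_S(g)|², where F_S
is the sum of the group S. This sum is bounded for each fixed g. In the Heisenberg picture every
layer splits the observable orthogonally into a trivial part, which keeps its norm, and a
non-trivial part, which shrinks by 1 - γ ≤ exp(-γ). A norm budget along the binary tree of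
splittings (`sum_norm_sq_chain_le`, `layerPart_adjoint`) gives at most exp(-2γL)‖O‖² for all
patterns with at least `L` non-trivial layers together.

Algorithm. The truncated sum is a transfer recursion over the layers that carries the remaining
budget (`sum_paths_le`). On a trivial block the matrix coefficients form the identity and the noise
eigenvalue is 1, so trivial layers only insert the projector Π₀. Unrolling them
(`segmentFunctional_tail`) leaves a tree: from a node, one contraction leads either to the end of
the circuit or to a non-trivial node, which consumes one unit of budget and branches into the
components of its block (`branch_zero`, `branch_succ`). The tree has height at most `L` and
branching number at most s·dmax. The program walks through this tree depth first with an explicit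
stack of tasks. Each iteration replaces a task by child tasks and adds a number to the accumulator;
the value of the task is that number plus the values of the children, and its time bound covers the
iteration and the bounds of the children. `runs_worklist` turns these local facts into correctness
and a bound for the whole run.

Memory layout: natural cell 0 is the stack pointer, 1 the number of stacked tasks, 2 the constant
one, 4 to 9 the current task, 10 to 13 mostly answers, 14 scratch, 15 the constant zero. Complex
cell 0 is the accumulator, 1 the factor of the current task, 2 and 3 scratch. The stack starts at
32. -/

namespace GroupCircuit

/-! ### A worklist machine -/

/-- The record of a pending task on the stack of the machine. -/
structure Rec where
  /-- the kind of the task -/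
  kind : ℕ
  /-- the remaining budget of non-trivial layers -/
  budget : ℕ
  /-- the layer -/
  layer : ℕ
  /-- the block -/
  block : ℕ
  /-- the component -/
  comp : ℕ
  /-- the position in a list of children -/
  pos : ℕ
  /-- the product of the factors collected so far -/
  factor : ℂ

/-- The memory cells below the address `p` hold the given records, the last one first. -/
def Stacked (σ : State) : ℕ → List Rec → Prop
  | p, [] => p = 32
  | p, w :: l => ∃ p', p = p' + 6 ∧ σ.nat p' = w.kind ∧ σ.nat (p' + 1) = w.budget ∧
      σ.nat (p' + 2) = w.layer ∧ σ.nat (p' + 3) = w.block ∧ σ.nat (p' + 4) = w.comp ∧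
      σ.nat (p' + 5) = w.pos ∧ σ.cpx p' = w.factor ∧ Stacked σ p' l

theorem Stacked.le {σ : State} {p : ℕ} {l : List Rec} (h : Stacked σ p l) : 32 ≤ p := by
  induction l generalizing p with
  | nil => exact le_of_eq h.symm
  | cons w l ih =>
    obtain ⟨p', rfl, -, -, -, -, -, -, -, h⟩ := h
    exact (ih h).trans (Nat.le_add_right _ _)

theorem Stacked.congr {σ τ : State} {p : ℕ} {l : List Rec} (h : Stacked σ p l)
    (hn : ∀ a, 32 ≤ a → a < p → τ.nat a = σ.nat a)
    (hc : ∀ a, 32 ≤ a → a < p → τ.cpx a = σ.cpx a) : Stacked τ p l := by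
  induction l generalizing p with
  | nil => exact h
  | cons w l ih =>
    obtain ⟨p', rfl, h0, h1, h2, h3, h4, h5, h6, h⟩ := h
    have hle := h.le
    refine ⟨p', rfl, ?_, ?_, ?_, ?_, ?_, ?_, ?_, ih h (fun a h1 h2 => hn a h1 (by omega))
      (fun a h1 h2 => hc a h1 (by omega))⟩
    all_goals first | rw [hn _ (by omega) (by omega)] | rw [hc _ (by omega) (by omega)]
    all_goals assumption

/-- The state `σ` has the register contents `ν` and `ζ` and the stack `l`. -/
structure Rep (σ : State) (ν : ℕ → ℕ) (ζ : ℕ → ℂ) (l : List Rec) : Prop where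
  nat : ∀ a, 2 ≤ a → a < 32 → σ.nat a = ν a
  cpx : ∀ a, a < 32 → σ.cpx a = ζ a
  stack : Stacked σ (σ.nat 0) l
  count : σ.nat 1 = l.length

/-- From all states represented by the first data, the program runs in time at most `T` to a state
represented by the second data. -/
def Sim (val : SubTable) (cost : Sub → ℕ) (p : Program) (T : ℕ)
    (ν : ℕ → ℕ) (ζ : ℕ → ℂ) (l : List Rec) (Q : (ℕ → ℕ) → (ℕ → ℂ) → List Rec → Prop) : Prop :=
  ∀ σ, Rep σ ν ζ l → ∃ τ t ν' ζ' l', Runs val cost p σ τ t ∧ t ≤ T ∧ Rep τ ν' ζ' l' ∧ Q ν' ζ' l'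

namespace Rep

variable {σ : State} {ν : ℕ → ℕ} {ζ : ℕ → ℂ} {l : List Rec}

theorem setN (h : Rep σ ν ζ l) (r v : ℕ) (hr : 2 ≤ r) (hr' : r < 32) :
    Rep (σ.setN r v) (Function.update ν r v) ζ l := by
  have h0 : (σ.setN r v).nat 0 = σ.nat 0 := Function.update_of_ne (by omega) _ _
  have h1 : (σ.setN r v).nat 1 = σ.nat 1 := Function.update_of_ne (by omega) _ _
  refine ⟨fun a ha ha' => ?_, h.cpx, ?_, by rw [h1, h.count]⟩
  · by_cases hra : a = r
    · subst hra; simp [State.setN]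
    · simp [State.setN, hra, h.nat a ha ha']
  · rw [h0]
    exact h.stack.congr (fun a ha _ => Function.update_of_ne (by omega) _ _) fun _ _ _ => rfl

theorem setC (h : Rep σ ν ζ l) (r : ℕ) (z : ℂ) (hr' : r < 32) :
    Rep (σ.setC r z) ν (Function.update ζ r z) l := by
  refine ⟨h.nat, fun a ha' => ?_, ?_, h.count⟩
  · by_cases hra : a = r
    · subst hra; simp [State.setC]
    · simp [State.setC, hra, h.cpx a ha']
  · exact h.stack.congr (fun a ha _ => rfl) fun a ha _ => Function.update_of_ne (by omega) _ _

end Rep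

/-! ### Symbolic execution rules for the instructions -/

namespace Sim

variable {val : SubTable} {cost : Sub → ℕ} {ν : ℕ → ℕ} {ζ : ℕ → ℂ} {l : List Rec}
  {Q : (ℕ → ℕ) → (ℕ → ℂ) → List Rec → Prop}

theorem seq {p q : Program} {T U V : ℕ} {R : (ℕ → ℕ) → (ℕ → ℂ) → List Rec → Prop}
    (hp : Sim val cost p T ν ζ l R)
    (hq : ∀ ν' ζ' l', R ν' ζ' l' → Sim val cost q U ν' ζ' l' Q) (hV : T + U ≤ V) :
    Sim val cost (.seq p q) V ν ζ l Q := by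
  intro σ hσ
  obtain ⟨τ, t, ν', ζ', l', hr, ht, hτ, hR⟩ := hp σ hσ
  obtain ⟨υ, u, ν'', ζ'', l'', hr', hu, hυ, hQ⟩ := hq _ _ _ hR τ hτ
  exact ⟨υ, t + u, ν'', ζ'', l'', hr.seq hr', by omega, hυ, hQ⟩

theorem const {r v : ℕ} (hr : 2 ≤ r ∧ r < 32) (h : Q (Function.update ν r v) ζ l) :
    Sim val cost (.const r v) 1 ν ζ l Q := fun σ hσ =>
  ⟨_, 1, _, _, _, .const σ r v, le_rfl, hσ.setN r v hr.1 hr.2, h⟩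

theorem add {r a b : ℕ} (hr : (2 ≤ r ∧ r < 32) ∧ (2 ≤ a ∧ a < 32) ∧ (2 ≤ b ∧ b < 32))
    (h : Q (Function.update ν r (ν a + ν b)) ζ l) :
    Sim val cost (.add r a b) 1 ν ζ l Q := fun σ hσ =>
  ⟨_, 1, _, _, _, .add σ r a b, le_rfl, by
    rw [hσ.nat a hr.2.1.1 hr.2.1.2, hσ.nat b hr.2.2.1 hr.2.2.2]
    exact hσ.setN r _ hr.1.1 hr.1.2, h⟩

theorem sub {r a b : ℕ} (hr : (2 ≤ r ∧ r < 32) ∧ (2 ≤ a ∧ a < 32) ∧ (2 ≤ b ∧ b < 32))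
    (h : Q (Function.update ν r (ν a - ν b)) ζ l) :
    Sim val cost (.sub r a b) 1 ν ζ l Q := fun σ hσ =>
  ⟨_, 1, _, _, _, .sub σ r a b, le_rfl, by
    rw [hσ.nat a hr.2.1.1 hr.2.1.2, hσ.nat b hr.2.2.1 hr.2.2.2]
    exact hσ.setN r _ hr.1.1 hr.1.2, h⟩

theorem cconst {r v : ℕ} (hr : r < 32) (h : Q ν (Function.update ζ r (v : ℂ)) l) :
    Sim val cost (.cconst r v) 1 ν ζ l Q := fun σ hσ =>
  ⟨_, 1, _, _, _, .cconst σ r v, le_rfl, hσ.setC r v hr, h⟩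

theorem cadd {r a b : ℕ} (hr : r < 32 ∧ a < 32 ∧ b < 32)
    (h : Q ν (Function.update ζ r (ζ a + ζ b)) l) :
    Sim val cost (.cadd r a b) 1 ν ζ l Q := fun σ hσ =>
  ⟨_, 1, _, _, _, .cadd σ r a b, le_rfl, by
    rw [hσ.cpx a hr.2.1, hσ.cpx b hr.2.2]
    exact hσ.setC r _ hr.1, h⟩

theorem cmul {r a b : ℕ} (hr : r < 32 ∧ a < 32 ∧ b < 32)
    (h : Q ν (Function.update ζ r (ζ a * ζ b)) l) :
    Sim val cost (.cmul r a b) 1 ν ζ l Q := fun σ hσ =>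
  ⟨_, 1, _, _, _, .cmul σ r a b, le_rfl, by
    rw [hσ.cpx a hr.2.1, hσ.cpx b hr.2.2]
    exact hσ.setC r _ hr.1, h⟩

theorem call {f : Sub} {a r c : ℕ} (hr : (2 ≤ r ∧ r < 29) ∧ (2 ≤ a ∧ a < 29) ∧ c < 32)
    (w : (Fin 4 → ℕ) × ℂ) (hw : val f (ν a) (ν (a + 1)) (ν (a + 2)) (ν (a + 3)) = w)
    (h : Q (Function.update (Function.update (Function.update (Function.update ν r (w.1 0))
      (r + 1) (w.1 1)) (r + 2) (w.1 2)) (r + 3) (w.1 3)) (Function.update ζ c w.2) l) :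
    Sim val cost (.call f a r c) (cost f) ν ζ l Q := fun σ hσ =>
  ⟨_, _, _, _, _, .call σ f a r c, le_rfl, by
    -- The bound 29 on `a` and `r` keeps the four consecutive cells of arguments and answers below
    -- the stack base 32.
    rw [hσ.nat a (by omega) (by omega), hσ.nat (a + 1) (by omega) (by omega),
      hσ.nat (a + 2) (by omega) (by omega), hσ.nat (a + 3) (by omega) (by omega), hw]
    exact ((((hσ.setN r _ (by omega) (by omega)).setN (r + 1) _ (by omega) (by omega)).setN
      (r + 2) _ (by omega) (by omega)).setN (r + 3) _ (by omega) (by omega)).setC c _ hr.2.2, h⟩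

theorem ifNonzero {p q : Program} {r T U : ℕ} (hr : 2 ≤ r ∧ r < 32)
    (hp : ν r ≠ 0 → Sim val cost p T ν ζ l Q) (hq : ν r = 0 → Sim val cost q T ν ζ l Q)
    (hU : T + 1 ≤ U) :
    Sim val cost (.ifNonzero r p q) U ν ζ l Q := by
  intro σ hσ
  have hv := hσ.nat r hr.1 hr.2
  by_cases h : ν r = 0
  · obtain ⟨τ, t, ν', ζ', l', hr, ht, hτ⟩ := hq h σ hσ
    exact ⟨τ, t + 1, ν', ζ', l', .ifFalse (hv.trans h) hr, by omega, hτ⟩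
  · obtain ⟨τ, t, ν', ζ', l', hr, ht, hτ⟩ := hp h σ hσ
    exact ⟨τ, t + 1, ν', ζ', l', .ifTrue (by rwa [hv]) hr, by omega, hτ⟩

theorem mono {p : Program} {T U : ℕ} (h : Sim val cost p T ν ζ l Q) (hU : T ≤ U) :
    Sim val cost p U ν ζ l Q := fun σ hσ =>
  let ⟨τ, t, ν', ζ', l', hr, ht, hτ⟩ := h σ hσ
  ⟨τ, t, ν', ζ', l', hr, ht.trans hU, hτ⟩

end Sim

/-! ### Pushing and popping tasks -/

/-- Store a register at the stack pointer, and advance the stack pointer. -/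
def pushCell (r : ℕ) : Program := .seq (.store 0 r) (.add 0 0 2)

/-- Move the stack pointer back, and load a register. -/
def popCell (r : ℕ) : Program := .seq (.sub 0 0 2) (.load r 0)

/-- Push the task in the registers `4, …, 9`. -/
def push : Program :=
  -- The factor is kept in the complex cell at the base address of the record. It is therefore
  -- written before the pointer moves, and `pop` reads it last.
  .seq (.cstore 0 1) <| .seq (pushCell 4) <| .seq (pushCell 5) <| .seq (pushCell 6) <|
    .seq (pushCell 7) <| .seq (pushCell 8) <| .seq (pushCell 9) (.add 1 1 2)

/-- Pop a task into the registers `4, …, 9`. -/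
def pop : Program :=
  .seq (.sub 1 1 2) <| .seq (popCell 9) <| .seq (popCell 8) <| .seq (popCell 7) <|
    .seq (popCell 6) <| .seq (popCell 5) <| .seq (popCell 4) (.cload 1 0)

theorem runs_pushCell {val : SubTable} {cost : Sub → ℕ} (σ : State) (r : ℕ) (h0 : 32 ≤ σ.nat 0)
    (h2 : σ.nat 2 = 1) :
    Runs val cost (pushCell r) σ
      ⟨Function.update (Function.update σ.nat (σ.nat 0) (σ.nat r)) 0 (σ.nat 0 + 1), σ.cpx⟩ 2 := by
  have h := (Runs.store (val := val) (cost := cost) σ 0 r).seq (Runs.add _ 0 0 2)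
  have e0 : (σ.setN (σ.nat 0) (σ.nat r)).nat 0 = σ.nat 0 := Function.update_of_ne (by omega) _ _
  have e2 : (σ.setN (σ.nat 0) (σ.nat r)).nat 2 = 1 := by
    rw [← h2]; exact Function.update_of_ne (by omega) _ _
  rw [e0, e2] at h
  exact h

theorem runs_popCell {val : SubTable} {cost : Sub → ℕ} (σ : State) (r : ℕ) (h0 : 33 ≤ σ.nat 0)
    (h2 : σ.nat 2 = 1) :
    Runs val cost (popCell r) σ
      ⟨Function.update (Function.update σ.nat 0 (σ.nat 0 - 1)) r (σ.nat (σ.nat 0 - 1)), σ.cpx⟩ 2 := by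
  have h := (Runs.sub (val := val) (cost := cost) σ 0 0 2).seq (Runs.load _ r 0)
  have e0 : (σ.setN 0 (σ.nat 0 - σ.nat 2)).nat 0 = σ.nat 0 - 1 := by simp [State.setN, h2]
  have e1 : (σ.setN 0 (σ.nat 0 - σ.nat 2)).nat (σ.nat 0 - 1) = σ.nat (σ.nat 0 - 1) :=
    Function.update_of_ne (by omega) _ _
  rw [e0, e1, h2] at h
  exact h

/-- The pointer never lies below 32, so the writes touch neither the registers nor the older
records. The time 14 is one complex store, six cells at two instructions each, and the update of the
counter. -/
theorem sim_push {val : SubTable} {cost : Sub → ℕ} {ν : ℕ → ℕ} {ζ : ℕ → ℂ} {l : List Rec}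
    {Q : (ℕ → ℕ) → (ℕ → ℂ) → List Rec → Prop} (h2 : ν 2 = 1)
    (h : Q ν ζ (⟨ν 4, ν 5, ν 6, ν 7, ν 8, ν 9, ζ 1⟩ :: l)) :
    Sim val cost push 14 ν ζ l Q := by
  intro σ hσ
  have hv2 : σ.nat 2 = 1 := (hσ.nat 2 (by omega) (by omega)).trans h2
  -- With the pointer in the form `s + 32`, `simp` can decide that stack addresses differ from
  -- register numbers and from each other.
  obtain ⟨s, hs⟩ : ∃ s, σ.nat 0 = s + 32 := ⟨_, (Nat.sub_add_cancel hσ.stack.le).symm⟩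
  have key := (Runs.cstore (val := val) (cost := cost) σ 0 1).seq <|
    (runs_pushCell _ 4 ?_ ?_).seq <| (runs_pushCell _ 5 ?_ ?_).seq <|
    (runs_pushCell _ 6 ?_ ?_).seq <| (runs_pushCell _ 7 ?_ ?_).seq <|
    (runs_pushCell _ 8 ?_ ?_).seq <| (runs_pushCell _ 9 ?_ ?_).seq <| Runs.add _ 1 1 2
  · refine ⟨_, _, ν, ζ, _, key, le_rfl, ⟨fun a ha ha' => ?_, fun a ha' => ?_, ?_, ?_⟩, h⟩
    · have h0 : a ≠ 0 := by omega
      have h1 : a ≠ 1 := by omega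
      simp only [State.setN, State.setC, Function.update_apply, hs, h0, h1, if_false, if_true,
        OfNat.ofNat_ne_zero, Nat.reduceEqDiff]
      repeat rw [if_neg (by omega)]
      exact hσ.nat a ha ha'
    · have h3 : a ≠ s + 32 := by omega
      simp [State.setN, State.setC, hs, h3, hσ.cpx a ha']
    · refine ⟨s + 32, ?_, ?_, ?_, ?_, ?_, ?_, ?_, ?_, ?_⟩
      case refine_9 =>
        refine (hs ▸ hσ.stack).congr (fun a ha ha' => ?_) fun a ha ha' => ?_
        · have h0 : a ≠ 0 := by omega
          have h1 : a ≠ 1 := by omega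
          simp only [State.setN, State.setC, Function.update_apply, hs, h0, h1, if_false, if_true,
            OfNat.ofNat_ne_zero, Nat.reduceEqDiff]
          repeat rw [if_neg (by omega)]
        · have h3 : a ≠ s + 32 := by omega
          simp [State.setN, State.setC, hs, h3]
      all_goals simp [State.setN, State.setC, hs]
      all_goals first | exact hσ.nat _ (by norm_num) (by norm_num) | exact hσ.cpx _ (by norm_num)
    · simp [State.setN, State.setC, hs, hv2, hσ.count]
  all_goals simp [State.setC, hs, hv2]

theorem sim_pop {val : SubTable} {cost : Sub → ℕ} {ν : ℕ → ℕ} {ζ : ℕ → ℂ} {w : Rec} {l : List Rec}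
    {Q : (ℕ → ℕ) → (ℕ → ℂ) → List Rec → Prop} (h2 : ν 2 = 1)
    (h : Q (fun a => if a = 4 then w.kind else if a = 5 then w.budget else if a = 6 then w.layer
      else if a = 7 then w.block else if a = 8 then w.comp else if a = 9 then w.pos else ν a)
      (Function.update ζ 1 w.factor) l) :
    Sim val cost pop 14 ν ζ (w :: l) Q := by
  intro σ hσ
  have hv2 : σ.nat 2 = 1 := (hσ.nat 2 (by omega) (by omega)).trans h2
  obtain ⟨p, hp, c0, c1, c2, c3, c4, c5, c6, hst⟩ := hσ.stack
  obtain ⟨s, rfl⟩ : ∃ s, p = s + 32 := ⟨_, (Nat.sub_add_cancel hst.le).symm⟩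
  have hs : σ.nat 0 = s + 38 := hp
  have key := (Runs.sub (val := val) (cost := cost) σ 1 1 2).seq <|
    (runs_popCell _ 9 ?_ ?_).seq <| (runs_popCell _ 8 ?_ ?_).seq <|
    (runs_popCell _ 7 ?_ ?_).seq <| (runs_popCell _ 6 ?_ ?_).seq <|
    (runs_popCell _ 5 ?_ ?_).seq <| (runs_popCell _ 4 ?_ ?_).seq <| Runs.cload _ 1 0
  · refine ⟨_, _, _, _, _, key, le_rfl, ⟨fun a ha ha' => ?_, fun a ha' => ?_, ?_, ?_⟩, h⟩
    · have h0 : a ≠ 0 := by omega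
      have h1 : a ≠ 1 := by omega
      simp [State.setN, State.setC, Function.update_apply, hs, h0, h1, c0, c1, c2, c3, c4, c5,
        hσ.nat a ha ha']
    · simp [State.setN, State.setC, Function.update_apply, hs, c6, hσ.cpx a ha']
    · have hn : ∀ a, 32 ≤ a → a ≠ 0 ∧ a ≠ 1 ∧ a ≠ 4 ∧ a ≠ 5 ∧ a ≠ 6 ∧ a ≠ 7 ∧ a ≠ 8 ∧ a ≠ 9 := by
        omega
      simp [State.setN, State.setC, hs]
      refine hst.congr (fun a ha ha' => ?_) fun a ha ha' => ?_
      · simp [hn a ha]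
      · exact Function.update_of_ne (hn a ha).2.1 _ _
    · simp [State.setN, State.setC, hs, hv2, hσ.count]
  all_goals simp [State.setN, hs, hv2]

/-! ### The worklist loop -/

/-- The state has the given stack and accumulator. -/
def Pending (σ : State) (l : List Rec) (acc : ℂ) : Prop :=
  ∃ ν ζ, Rep σ ν ζ l ∧ ν 2 = 1 ∧ ν 15 = 0 ∧ ζ 0 = acc

/-- Potential argument: the accumulator plus the values of the pending tasks is invariant, and the
total time bound of the pending tasks drops in each iteration by at least the time of the iteration
and its loop test. The final `+ 1` pays for the test that ends the loop. -/
theorem runs_worklist {val : SubTable} {cost : Sub → ℕ} {body : Program} {ι : Type}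
    (enc : ι → Rec) (value : ι → ℂ) (time : ι → ℕ)
    (h : ∀ w l σ acc, Pending σ (enc w :: l) acc → ∃ (τ : State) (t : ℕ) (ws : List ι) (c : ℂ), Runs val cost body σ τ t ∧
      Pending τ (ws.map enc ++ l) (acc + c) ∧ t + 1 + (ws.map time).sum ≤ time w ∧
      value w = c + (ws.map value).sum)
    (ws : List ι) (σ : State) (acc : ℂ) (hσ : Pending σ (ws.map enc) acc) :
    ∃ τ t, Runs val cost (.whileNonzero 1 body) σ τ t ∧ t ≤ (ws.map time).sum + 1 ∧
      τ.cpx 0 = acc + (ws.map value).sum := by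
  obtain ⟨N, hN⟩ : ∃ N, (ws.map time).sum ≤ N := ⟨_, le_rfl⟩
  induction N using Nat.strong_induction_on generalizing ws σ acc with
  | _ N ih =>
  cases ws with
  | nil =>
    obtain ⟨ν, ζ, hr, -, -, h0⟩ := hσ
    refine ⟨σ, 1, .whileStop (by simpa using hr.count), by simp, ?_⟩
    rw [hr.cpx 0 (by norm_num), h0]
    simp
  | cons w ws =>
    obtain ⟨τ, t, ws', c, hrun, hτ, ht, hv⟩ := h w (ws.map enc) σ acc hσ
    have hcount : σ.nat 1 ≠ 0 := by
      obtain ⟨ν, ζ, hr, -⟩ := hσ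
      rw [hr.count]; simp
    simp only [List.map_cons, List.sum_cons] at hN
    rw [← List.map_append] at hτ
    -- The loop test alone costs one unit, so the potential drops strictly and strong induction
    -- applies whatever the number of new tasks.
    obtain ⟨υ, u, hrun', hu, hval⟩ := ih (N - 1) (by omega) (ws' ++ ws) τ (acc + c) hτ (by
      rw [List.map_append, List.sum_append]; omega)
    rw [List.map_append, List.sum_append] at hu hval
    refine ⟨υ, t + u + 1, .whileStep hcount hrun hrun', ?_, ?_⟩
    · simp only [List.map_cons, List.sum_cons]; omega
    · rw [hval, List.map_cons, List.sum_cons, hv]; ring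

namespace Sim

variable {val : SubTable} {cost : Sub → ℕ} {ν ν' : ℕ → ℕ} {ζ ζ' : ℕ → ℂ} {l l' : List Rec}
  {Q : (ℕ → ℕ) → (ℕ → ℂ) → List Rec → Prop}

/-- The rule for the first program is taken for every postcondition, so unification reads off the
exact state that it produces, and a program can be executed symbolically one instruction at a time.
The remaining time `V - T` is passed on. -/
theorem andThen {p q : Program} {T V : ℕ}
    (hp : ∀ Q : (ℕ → ℕ) → (ℕ → ℂ) → List Rec → Prop, Q ν' ζ' l' → Sim val cost p T ν ζ l Q)
    (hq : Sim val cost q (V - T) ν' ζ' l' Q) (hV : T ≤ V := by omega) :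
    Sim val cost (.seq p q) V ν ζ l Q :=
  seq (hp (fun a b c => a = ν' ∧ b = ζ' ∧ c = l') ⟨rfl, rfl, rfl⟩)
    (by rintro _ _ _ ⟨rfl, rfl, rfl⟩; exact hq) (Nat.add_sub_of_le hV).le

theorem last {p : Program} {T V : ℕ}
    (hp : ∀ Q : (ℕ → ℕ) → (ℕ → ℂ) → List Rec → Prop, Q ν' ζ' l' → Sim val cost p T ν ζ l Q)
    (hQ : Q ν' ζ' l') (hV : T ≤ V := by omega) : Sim val cost p V ν ζ l Q :=
  (hp Q hQ).mono hV

theorem ifTrue {p q : Program} {r V : ℕ} (hr : 2 ≤ r ∧ r < 32) (h : ν r ≠ 0)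
    (hp : Sim val cost p (V - 1) ν ζ l Q) (hV : 1 ≤ V := by omega) :
    Sim val cost (.ifNonzero r p q) V ν ζ l Q :=
  ifNonzero hr (fun _ => hp) (fun h' => absurd h' h) (by omega)

theorem ifFalse {p q : Program} {r V : ℕ} (hr : 2 ≤ r ∧ r < 32) (h : ν r = 0)
    (hq : Sim val cost q (V - 1) ν ζ l Q) (hV : 1 ≤ V := by omega) :
    Sim val cost (.ifNonzero r p q) V ν ζ l Q :=
  ifNonzero hr (fun h' => absurd h h') (fun _ => hq) (by omega)

end Sim

/-! ### The program -/

/-- The instruction without effect. -/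
def skip : Program := .const 14 0

/-- Handle a task of kind 2: for each component of a block, multiply with a matrix coefficient. -/
def matTask : Program :=
  .ifNonzero 9
    -- After the decrement, cell 9 is both the number of components left for the task that is pushed
    -- back and the index of the component treated now; components are treated in descending order.
    -- Adding cell 15, which is zero, serves as a copy instruction here and below.
    (.seq (.sub 9 9 2) <| .seq push <| .seq (.call .matrixCoeff 6 10 2) <| .seq (.cmul 1 1 2) <|
      .seq (.const 4 1) <| .seq (.add 8 9 15) <| .seq (.const 9 0) push)
    skip

/-- Multiply with the overlap with the input state, and add to the accumulator. -/
def finish : Program := .seq (.call .overlap 6 10 2) <| .seq (.cmul 3 1 2) (.cadd 0 0 3)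

/-- Handle a task of kind 1: go through the terms of a contraction. -/
def conTask : Program :=
  .ifNonzero 5
    (.seq (.call .contract 6 10 2) <|
      .ifNonzero 10
        (.seq (.sub 14 10 2) <|
          .ifNonzero 14
            (.seq finish <| .seq (.add 9 9 2) push)
            (.seq (.add 9 9 2) <| .seq push <| .seq (.cmul 1 1 2) <| .seq (.sub 5 5 2) <|
              .seq (.const 4 2) <| .seq (.add 6 11 15) <| .seq (.add 7 12 15) <|
              .seq (.add 8 13 15) <| .seq (.call .dim 6 9 2) push))
        skip)
    finish

/-- Handle a task of kind 0: go through the expansion of the observable. -/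
def rootTask : Program :=
  .seq (.call .root 9 10 2) <|
    .ifNonzero 10
      (.seq (.add 9 9 2) <| .seq push <| .seq (.add 7 11 15) <| .seq (.add 8 12 15) <|
        .seq (.const 9 0) <| .seq (.cconst 1 0) <| .seq (.cadd 1 1 2) <|
        .seq (.call .trivial 6 10 3) <|
        .ifNonzero 10
          (.seq (.const 4 1) push)
          (.ifNonzero 5
            (.seq (.sub 5 5 2) <| .seq (.const 4 2) <| .seq (.call .dim 6 9 3) push)
            skip))
      skip

/-- Handle one task. -/
def handle : Program :=
  .seq pop <|
    .ifNonzero 4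
      (.seq (.sub 14 4 2) (.ifNonzero 14 matTask conTask))
      rootTask

/-- The evaluation of the truncated path sum. -/
def program : Program :=
  -- The input is moved from cell 0 to the budget register before cell 0 becomes the stack pointer.
  -- All other fields of the first task are zero because the memory initially is.
  .seq (.const 2 1) <| .seq (.add 5 0 15) <| .seq (.const 0 32) <| .seq push <|
    .whileNonzero 1 handle

/-! ### The effect of one iteration, for each kind of task -/

section Handle

variable {val : SubTable} {cost : Sub → ℕ} {l : List Rec} {σ : State} {acc : ℂ}

theorem Sim.pending {p : Program} {T : ℕ} {w : Rec} {l' : List Rec} {acc' : ℂ}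
    (h : ∀ ν ζ, ν 2 = 1 → ν 15 = 0 → ζ 0 = acc → Sim val cost p T ν ζ (w :: l)
      fun ν' ζ' k => (ν' 2 = 1 ∧ ν' 15 = 0) ∧ ζ' 0 = acc' ∧ k = l')
    (hσ : Pending σ (w :: l) acc) :
    ∃ τ t, Runs val cost p σ τ t ∧ t ≤ T ∧ Pending τ l' acc' := by
  obtain ⟨ν, ζ, hr, h2, h15, h0⟩ := hσ
  obtain ⟨τ, t, ν', ζ', k, hrun, ht, hτ, h3, h4, rfl⟩ := h ν ζ h2 h15 h0 σ hr
  exact ⟨τ, t, hrun, ht, ν', ζ', hτ, h3.1, h3.2, h4⟩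

theorem sim_finish {ν : ℕ → ℕ} {ζ : ℕ → ℂ} {Q : (ℕ → ℕ) → (ℕ → ℂ) → List Rec → Prop}
    {a : Fin 4 → ℕ} {v : ℂ} (hv : val .overlap (ν 6) (ν 7) (ν 8) (ν 9) = (a, v))
    (h : Q (Function.update (Function.update (Function.update (Function.update ν 10 (a 0))
      11 (a 1)) 12 (a 2)) 13 (a 3))
      (Function.update (Function.update (Function.update ζ 2 v) 3 (ζ 1 * v)) 0 (ζ 0 + ζ 1 * v)) l) :
    Sim val cost finish (cost .overlap + 2) ν ζ l Q := by
  refine Sim.andThen (fun _ => Sim.call (by norm_num) (a, v) hv) ?_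
  refine Sim.andThen (fun _ => Sim.cmul (by norm_num)) ?_
  refine Sim.last (fun _ => Sim.cadd (by norm_num)) ?_
  simpa using h

/-- In this and the following cases the program is executed symbolically along the branch selected
by the kind, the budget and the answers. The number 100 is a generous common bound for the unit-cost
instructions; the subroutine calls are counted separately. -/
theorem handle_mat_zero {ℓ i β k : ℕ} {c : ℂ} (hσ : Pending σ (⟨2, ℓ, i, β, k, 0, c⟩ :: l) acc) :
    ∃ τ t, Runs val cost handle σ τ t ∧ t ≤ 100 ∧ Pending τ l acc := by
  refine Sim.pending (fun ν ζ h2 h15 h0 => ?_) hσ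
  refine Sim.andThen (fun _ => sim_pop h2) ?_
  refine Sim.ifTrue (by norm_num) (by simp) ?_
  refine Sim.andThen (fun _ => Sim.sub (by norm_num)) ?_
  refine Sim.ifTrue (by norm_num) (by simp [h2]) ?_
  refine Sim.ifFalse (by norm_num) (by simp) ?_
  refine Sim.last (fun _ => Sim.const (by norm_num)) ?_
  simp [h2, h15, h0]

theorem handle_mat_succ {ℓ i β k q : ℕ} {c v : ℂ} {a : Fin 4 → ℕ}
    (hv : val .matrixCoeff i β k q = (a, v))
    (hσ : Pending σ (⟨2, ℓ, i, β, k, q + 1, c⟩ :: l) acc) :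
    ∃ τ t, Runs val cost handle σ τ t ∧ t ≤ 100 + cost .matrixCoeff ∧
      Pending τ (⟨1, ℓ, i, β, q, 0, c * v⟩ :: ⟨2, ℓ, i, β, k, q, c⟩ :: l) acc := by
  refine Sim.pending (fun ν ζ h2 h15 h0 => ?_) hσ
  refine Sim.andThen (fun _ => sim_pop h2) ?_
  refine Sim.ifTrue (by norm_num) (by simp) ?_
  refine Sim.andThen (fun _ => Sim.sub (by norm_num)) ?_
  refine Sim.ifTrue (by norm_num) (by simp [h2]) ?_
  refine Sim.ifTrue (by norm_num) (by simp) ?_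
  refine Sim.andThen (fun _ => Sim.sub (by norm_num)) ?_
  refine Sim.andThen (fun _ => sim_push (by simp [h2])) ?_
  refine Sim.andThen (fun _ => Sim.call (by norm_num) (a, v) (by simp [h2, hv])) ?_
  refine Sim.andThen (fun _ => Sim.cmul (by norm_num)) ?_
  refine Sim.andThen (fun _ => Sim.const (by norm_num)) ?_
  refine Sim.andThen (fun _ => Sim.add (by norm_num)) ?_
  refine Sim.andThen (fun _ => Sim.const (by norm_num)) ?_
  refine Sim.last (fun _ => sim_push (by simp [h2])) ?_
  simp [h2, h15, h0]

theorem handle_con_leaf {i β k q : ℕ} {c v : ℂ} {a : Fin 4 → ℕ}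
    (hv : val .overlap i β k q = (a, v))
    (hσ : Pending σ (⟨1, 0, i, β, k, q, c⟩ :: l) acc) :
    ∃ τ t, Runs val cost handle σ τ t ∧ t ≤ 100 + cost .overlap ∧
      Pending τ l (acc + c * v) := by
  refine Sim.pending (fun ν ζ h2 h15 h0 => ?_) hσ
  refine Sim.andThen (fun _ => sim_pop h2) ?_
  refine Sim.ifTrue (by norm_num) (by simp) ?_
  refine Sim.andThen (fun _ => Sim.sub (by norm_num)) ?_
  refine Sim.ifFalse (by norm_num) (by simp [h2]) ?_
  refine Sim.ifFalse (by norm_num) (by simp) ?_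
  refine Sim.last (fun _ => sim_finish (a := a) (v := v) (by simp [hv])) ?_
  simp [h2, h15, h0]

theorem handle_con_nil {ℓ i β k q : ℕ} {c v : ℂ}
    (hv : val .contract i β k q = (0, v))
    (hσ : Pending σ (⟨1, ℓ + 1, i, β, k, q, c⟩ :: l) acc) :
    ∃ τ t, Runs val cost handle σ τ t ∧ t ≤ 100 + cost .contract ∧
      Pending τ l acc := by
  refine Sim.pending (fun ν ζ h2 h15 h0 => ?_) hσ
  refine Sim.andThen (fun _ => sim_pop h2) ?_
  refine Sim.ifTrue (by norm_num) (by simp) ?_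
  refine Sim.andThen (fun _ => Sim.sub (by norm_num)) ?_
  refine Sim.ifFalse (by norm_num) (by simp [h2]) ?_
  refine Sim.ifTrue (by norm_num) (by simp) ?_
  refine Sim.andThen (fun _ => Sim.call (by norm_num) (0, v) (by simp [hv])) ?_
  refine Sim.ifFalse (by norm_num) (by simp) ?_
  refine Sim.last (fun _ => Sim.const (by norm_num)) ?_
  simp [h2, h15, h0]

theorem handle_con_end {ℓ i β k q : ℕ} {c u v : ℂ} {a : Fin 4 → ℕ}
    (hu : val .contract i β k q = (![2, 0, 0, 0], u)) (hv : val .overlap i β k q = (a, v))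
    (hσ : Pending σ (⟨1, ℓ + 1, i, β, k, q, c⟩ :: l) acc) :
    ∃ τ t, Runs val cost handle σ τ t ∧ t ≤ 100 + cost .contract + cost .overlap ∧
      Pending τ (⟨1, ℓ + 1, i, β, k, q + 1, c⟩ :: l) (acc + c * v) := by
  refine Sim.pending (fun ν ζ h2 h15 h0 => ?_) hσ
  refine Sim.andThen (fun _ => sim_pop h2) ?_
  refine Sim.ifTrue (by norm_num) (by simp) ?_
  refine Sim.andThen (fun _ => Sim.sub (by norm_num)) ?_
  refine Sim.ifFalse (by norm_num) (by simp [h2]) ?_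
  refine Sim.ifTrue (by norm_num) (by simp) ?_
  refine Sim.andThen (fun _ => Sim.call (by norm_num) (![2, 0, 0, 0], u) (by simp [hu])) ?_
  refine Sim.ifTrue (by norm_num) (by simp) ?_
  refine Sim.andThen (fun _ => Sim.sub (by norm_num)) ?_
  refine Sim.ifTrue (by norm_num) (by simp [h2]) ?_
  refine Sim.andThen (fun _ => sim_finish (a := a) (v := v) (by simp [hv])) ?_
  refine Sim.andThen (fun _ => Sim.add (by norm_num)) ?_
  refine Sim.last (fun _ => sim_push (by simp [h2])) ?_
  simp [h2, h15, h0]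

theorem handle_con_node {ℓ i β k q i' β' k' m : ℕ} {c u v : ℂ}
    (hu : val .contract i β k q = (![1, i', β', k'], u))
    (hv : ∀ x y, val .dim i' β' x y = (![m, 0, 0, 0], v))
    (hσ : Pending σ (⟨1, ℓ + 1, i, β, k, q, c⟩ :: l) acc) :
    ∃ τ t, Runs val cost handle σ τ t ∧ t ≤ 100 + cost .contract + cost .dim ∧
      Pending τ (⟨2, ℓ, i', β', k', m, c * u⟩ :: ⟨1, ℓ + 1, i, β, k, q + 1, c⟩ :: l) acc := by
  refine Sim.pending (fun ν ζ h2 h15 h0 => ?_) hσ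
  refine Sim.andThen (fun _ => sim_pop h2) ?_
  refine Sim.ifTrue (by norm_num) (by simp) ?_
  refine Sim.andThen (fun _ => Sim.sub (by norm_num)) ?_
  refine Sim.ifFalse (by norm_num) (by simp [h2]) ?_
  refine Sim.ifTrue (by norm_num) (by simp) ?_
  refine Sim.andThen (fun _ => Sim.call (by norm_num) (![1, i', β', k'], u) (by simp [hu])) ?_
  refine Sim.ifTrue (by norm_num) (by simp) ?_
  refine Sim.andThen (fun _ => Sim.sub (by norm_num)) ?_
  refine Sim.ifFalse (by norm_num) (by simp [h2]) ?_
  refine Sim.andThen (fun _ => Sim.add (by norm_num)) ?_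
  refine Sim.andThen (fun _ => sim_push (by simp [h2])) ?_
  refine Sim.andThen (fun _ => Sim.cmul (by norm_num)) ?_
  refine Sim.andThen (fun _ => Sim.sub (by norm_num)) ?_
  refine Sim.andThen (fun _ => Sim.const (by norm_num)) ?_
  refine Sim.andThen (fun _ => Sim.add (by norm_num)) ?_
  refine Sim.andThen (fun _ => Sim.add (by norm_num)) ?_
  refine Sim.andThen (fun _ => Sim.add (by norm_num)) ?_
  refine Sim.andThen (fun _ => Sim.call (by norm_num) (![m, 0, 0, 0], v) (by simp [h15, hv])) ?_
  refine Sim.last (fun _ => sim_push (by simp [h2])) ?_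
  simp [h2, h15, h0]

theorem handle_root_nil {ℓ q : ℕ} {c v : ℂ}
    (hv : ∀ x y z, val .root q x y z = (0, v))
    (hσ : Pending σ (⟨0, ℓ, 0, 0, 0, q, c⟩ :: l) acc) :
    ∃ τ t, Runs val cost handle σ τ t ∧ t ≤ 100 + cost .root ∧
      Pending τ l acc := by
  refine Sim.pending (fun ν ζ h2 h15 h0 => ?_) hσ
  refine Sim.andThen (fun _ => sim_pop h2) ?_
  refine Sim.ifFalse (by norm_num) (by simp) ?_
  refine Sim.andThen (fun _ => Sim.call (by norm_num) (0, v) (by simp [hv])) ?_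
  refine Sim.ifFalse (by norm_num) (by simp) ?_
  refine Sim.last (fun _ => Sim.const (by norm_num)) ?_
  simp [h2, h15, h0]

theorem handle_root_trivial {ℓ q β k : ℕ} {c u v : ℂ}
    (hu : ∀ x y z, val .root q x y z = (![1, β, k, 0], u))
    (hv : ∀ x y, val .trivial 0 β x y = (![1, 0, 0, 0], v))
    (hσ : Pending σ (⟨0, ℓ, 0, 0, 0, q, c⟩ :: l) acc) :
    ∃ τ t, Runs val cost handle σ τ t ∧ t ≤ 100 + cost .root + cost .trivial ∧
      Pending τ (⟨1, ℓ, 0, β, k, 0, u⟩ :: ⟨0, ℓ, 0, 0, 0, q + 1, c⟩ :: l) acc := by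
  refine Sim.pending (fun ν ζ h2 h15 h0 => ?_) hσ
  refine Sim.andThen (fun _ => sim_pop h2) ?_
  refine Sim.ifFalse (by norm_num) (by simp) ?_
  refine Sim.andThen (fun _ => Sim.call (by norm_num) (![1, β, k, 0], u) (by simp [hu])) ?_
  refine Sim.ifTrue (by norm_num) (by simp) ?_
  refine Sim.andThen (fun _ => Sim.add (by norm_num)) ?_
  refine Sim.andThen (fun _ => sim_push (by simp [h2])) ?_
  refine Sim.andThen (fun _ => Sim.add (by norm_num)) ?_
  refine Sim.andThen (fun _ => Sim.add (by norm_num)) ?_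
  refine Sim.andThen (fun _ => Sim.const (by norm_num)) ?_
  refine Sim.andThen (fun _ => Sim.cconst (by norm_num)) ?_
  refine Sim.andThen (fun _ => Sim.cadd (by norm_num)) ?_
  refine Sim.andThen (fun _ => Sim.call (by norm_num) (![1, 0, 0, 0], v) (by simp [h15, hv])) ?_
  refine Sim.ifTrue (by norm_num) (by simp) ?_
  refine Sim.andThen (fun _ => Sim.const (by norm_num)) ?_
  refine Sim.last (fun _ => sim_push (by simp [h2])) ?_
  simp [h2, h15, h0]

theorem handle_root_skip {q β k : ℕ} {c u v : ℂ}
    (hu : ∀ x y z, val .root q x y z = (![1, β, k, 0], u))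
    (hv : ∀ x y, val .trivial 0 β x y = (![0, 0, 0, 0], v))
    (hσ : Pending σ (⟨0, 0, 0, 0, 0, q, c⟩ :: l) acc) :
    ∃ τ t, Runs val cost handle σ τ t ∧ t ≤ 100 + cost .root + cost .trivial ∧
      Pending τ (⟨0, 0, 0, 0, 0, q + 1, c⟩ :: l) acc := by
  refine Sim.pending (fun ν ζ h2 h15 h0 => ?_) hσ
  refine Sim.andThen (fun _ => sim_pop h2) ?_
  refine Sim.ifFalse (by norm_num) (by simp) ?_
  refine Sim.andThen (fun _ => Sim.call (by norm_num) (![1, β, k, 0], u) (by simp [hu])) ?_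
  refine Sim.ifTrue (by norm_num) (by simp) ?_
  refine Sim.andThen (fun _ => Sim.add (by norm_num)) ?_
  refine Sim.andThen (fun _ => sim_push (by simp [h2])) ?_
  refine Sim.andThen (fun _ => Sim.add (by norm_num)) ?_
  refine Sim.andThen (fun _ => Sim.add (by norm_num)) ?_
  refine Sim.andThen (fun _ => Sim.const (by norm_num)) ?_
  refine Sim.andThen (fun _ => Sim.cconst (by norm_num)) ?_
  refine Sim.andThen (fun _ => Sim.cadd (by norm_num)) ?_
  refine Sim.andThen (fun _ => Sim.call (by norm_num) (![0, 0, 0, 0], v) (by simp [h15, hv])) ?_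
  refine Sim.ifFalse (by norm_num) (by simp) ?_
  refine Sim.ifFalse (by norm_num) (by simp) ?_
  refine Sim.last (fun _ => Sim.const (by norm_num)) ?_
  simp [h2, h15, h0]

theorem handle_root_nontrivial {ℓ q β k m : ℕ} {c u v x : ℂ}
    (hu : ∀ x y z, val .root q x y z = (![1, β, k, 0], u))
    (hv : ∀ x y, val .trivial 0 β x y = (![0, 0, 0, 0], v))
    (hx : ∀ y z, val .dim 0 β y z = (![m, 0, 0, 0], x))
    (hσ : Pending σ (⟨0, ℓ + 1, 0, 0, 0, q, c⟩ :: l) acc) :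
    ∃ τ t, Runs val cost handle σ τ t ∧ t ≤ 100 + cost .root + cost .trivial + cost .dim ∧
      Pending τ (⟨2, ℓ, 0, β, k, m, u⟩ :: ⟨0, ℓ + 1, 0, 0, 0, q + 1, c⟩ :: l) acc := by
  refine Sim.pending (fun ν ζ h2 h15 h0 => ?_) hσ
  refine Sim.andThen (fun _ => sim_pop h2) ?_
  refine Sim.ifFalse (by norm_num) (by simp) ?_
  refine Sim.andThen (fun _ => Sim.call (by norm_num) (![1, β, k, 0], u) (by simp [hu])) ?_
  refine Sim.ifTrue (by norm_num) (by simp) ?_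
  refine Sim.andThen (fun _ => Sim.add (by norm_num)) ?_
  refine Sim.andThen (fun _ => sim_push (by simp [h2])) ?_
  refine Sim.andThen (fun _ => Sim.add (by norm_num)) ?_
  refine Sim.andThen (fun _ => Sim.add (by norm_num)) ?_
  refine Sim.andThen (fun _ => Sim.const (by norm_num)) ?_
  refine Sim.andThen (fun _ => Sim.cconst (by norm_num)) ?_
  refine Sim.andThen (fun _ => Sim.cadd (by norm_num)) ?_
  refine Sim.andThen (fun _ => Sim.call (by norm_num) (![0, 0, 0, 0], v) (by simp [h15, hv])) ?_
  refine Sim.ifFalse (by norm_num) (by simp) ?_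
  refine Sim.ifTrue (by norm_num) (by simp) ?_
  refine Sim.andThen (fun _ => Sim.sub (by norm_num)) ?_
  refine Sim.andThen (fun _ => Sim.const (by norm_num)) ?_
  refine Sim.andThen (fun _ => Sim.call (by norm_num) (![m, 0, 0, 0], x) (by simp [h15, hx])) ?_
  refine Sim.last (fun _ => sim_push (by simp [h2])) ?_
  simp [h2, h15, h0]

theorem runs_program {ι : Type} (enc : ι → Rec) (value : ι → ℂ) (time : ι → ℕ)
    (h : ∀ w l σ acc, Pending σ (enc w :: l) acc →
      ∃ (τ : State) (t : ℕ) (ws : List ι) (c : ℂ), Runs val cost handle σ τ t ∧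
      Pending τ (ws.map enc ++ l) (acc + c) ∧ t + 1 + (ws.map time).sum ≤ time w ∧
      value w = c + (ws.map value).sum)
    (L : ℕ) (w : ι) (hw : enc w = ⟨0, L, 0, 0, 0, 0, 0⟩) :
    ∃ τ t, Runs val cost program (State.init L) τ t ∧ τ.cpx 0 = value w ∧ t ≤ time w + 18 := by
  let σ : State := (((State.init L).setN 2 1).setN 5 (L + 0)).setN 0 32
  have hσ : Rep σ σ.nat σ.cpx [] := ⟨fun _ _ _ => rfl, fun _ _ => rfl, rfl, rfl⟩
  obtain ⟨τ, t, ν, ζ, l, hr, ht, hτ, h2, h15, h0, rfl⟩ := sim_push (val := val) (cost := cost)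
    (Q := fun ν ζ l => ν 2 = 1 ∧ ν 15 = 0 ∧ ζ 0 = 0 ∧ l = [w].map enc) (by rfl)
    (by simp [σ, hw, State.setN, State.init]) σ hσ
  obtain ⟨υ, u, hr', hu, hυ⟩ := runs_worklist enc value time h [w] τ 0 ⟨ν, ζ, hτ, h2, h15, h0⟩
  refine ⟨υ, _, (Runs.const _ 2 1).seq <| (Runs.add _ 5 0 15).seq <| (Runs.const _ 0 32).seq <|
    hr.seq hr', ?_, ?_⟩
  · simpa using hυ
  -- The constant 18 consists of three initial instructions, 14 for the push and 1 for the last loop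
  -- test.
  · simp only [List.map_cons, List.map_nil, List.sum_cons, List.sum_nil] at hu
    omega

end Handle

/-! ### The Hilbert-Schmidt inner product -/

section HilbertSchmidt

variable {n d : ℕ}

/-- The Hilbert-Schmidt inner product with a fixed operator, as a functional. -/
noncomputable def hsFunctional (A : QOp n d) : QOp n d →ₗ[ℂ] ℂ :=
  (Matrix.traceLinearMap _ ℂ ℂ).comp (LinearMap.mulLeft ℂ Aᴴ)

theorem hsInner_add (A X Y : QOp n d) : hsInner A (X + Y) = hsInner A X + hsInner A Y :=
  (hsFunctional A).map_add X Y

theorem hsInner_zero (A : QOp n d) : hsInner A 0 = 0 := (hsFunctional A).map_zero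

theorem hsInner_smul (A : QOp n d) (c : ℂ) (X : QOp n d) : hsInner A (c • X) = c * hsInner A X :=
  (hsFunctional A).map_smul c X

theorem hsInner_sum {ι : Type*} (s : Finset ι) (A : QOp n d) (X : ι → QOp n d) :
    hsInner A (∑ i ∈ s, X i) = ∑ i ∈ s, hsInner A (X i) := map_sum (hsFunctional A) X s

theorem star_hsInner (A B : QOp n d) : star (hsInner A B) = hsInner B A := by
  rw [hsInner, hsInner, ← Matrix.trace_conjTranspose, Matrix.conjTranspose_mul,
    Matrix.conjTranspose_conjTranspose]

theorem hsInner_conj (A V X : QOp n d) : hsInner A (V * X * Vᴴ) = hsInner (Vᴴ * A * V) X := by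
  simp only [hsInner, Matrix.conjTranspose_mul, Matrix.conjTranspose_conjTranspose]
  rw [← Matrix.mul_assoc, Matrix.trace_mul_comm, ← Matrix.mul_assoc, ← Matrix.mul_assoc,
    ← Matrix.mul_assoc]

theorem hsInner_of_isHermitian {O : QOp n d} (hO : O.IsHermitian) (X : QOp n d) :
    hsInner O X = (O * X).trace := by rw [hsInner, hO.eq]

end HilbertSchmidt

namespace ITOBasis

variable {G : Type*} [Group G] {n d : ℕ} {U : G →* Matrix.unitaryGroup (Config n d) ℂ}

theorem hsInner_op (B : ITOBasis U) (a b : B.Label) :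
    hsInner (B.op a) (B.op b) = if a = b then 1 else 0 := B.orthonormal a.1 a.2 b.1 b.2

/-- Orthonormality settles the basis operators themselves, and completeness extends the expansion to
all operators by linearity. -/
theorem sum_hsInner_smul_op (B : ITOBasis U) (X : QOp n d) :
    ∑ a : B.Label, hsInner (B.op a) X • B.op a = X := by
  have hX : X ∈ Submodule.span ℂ {X | ∃ β k, X = B.T β k} := by
    rw [B.complete]; exact Submodule.mem_top
  induction hX using Submodule.span_induction with
  | mem X hX =>
    obtain ⟨β, k, rfl⟩ := hX
    have : B.T β k = B.op ⟨β, k⟩ := rfl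
    simp [this, hsInner_op]
  | zero => simp [hsInner_zero]
  | add X Y _ _ hX hY => simp [hsInner_add, add_smul, Finset.sum_add_distrib, hX, hY]
  | smul c X _ hX => simp [hsInner_smul, mul_smul, ← Finset.smul_sum, hX]

/-- This is used twice: trivial layers drop out of the tree, and they contribute constants to the
Haar integrals. -/
theorem coeff_of_trivial (B : ITOBasis U) {β : Fin B.numBlocks} (h : B.Trivial β) (g : G)
    (k k' : Fin (B.dim β)) : B.coeff β g k k' = if k = k' then 1 else 0 := by
  rw [coeff, h.out g, LinearMap.toMatrix'_id, Matrix.one_apply]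

end ITOBasis

/-! ### Sums over paths -/

/-- The vector with which a path enters the layer `m`; past the last layer, the vector `v`. -/
noncomputable def ketAt {V : Type*} {D : ℕ} {α : Fin D → Type*} (ket : ∀ i, α i → V) (v : V)
    (p : ∀ i, α i) (m : ℕ) : V := if h : m < D then ket ⟨m, h⟩ (p ⟨m, h⟩) else v

theorem ketAt_cons_zero {V : Type*} {D : ℕ} {α : Fin (D + 1) → Type*} (ket : ∀ i, α i → V) (v : V)
    (x : α 0) (p : ∀ i : Fin D, α i.succ) : ketAt ket v (Fin.cons x p) 0 = ket 0 x := by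
  rw [ketAt, dif_pos D.succ_pos]; rfl

theorem ketAt_cons_succ {V : Type*} {D : ℕ} {α : Fin (D + 1) → Type*} (ket : ∀ i, α i → V) (v : V)
    (x : α 0) (p : ∀ i : Fin D, α i.succ) (m : ℕ) :
    ketAt ket v (Fin.cons x p) (m + 1) = ketAt (fun i => ket i.succ) v p m := by
  by_cases h : m < D
  · rw [ketAt, ketAt, dif_pos h, dif_pos (Nat.succ_lt_succ h)]; rfl
  · rw [ketAt, ketAt, dif_neg h, dif_neg (by omega)]

/-- A weight couples neighbouring layers only, so the sum over paths is an iterated transfer map. To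
respect the bound on the degree, the fold carries vectors that depend on the remaining budget. In
the induction the functional `φ` is replaced by the functional of the first step, and the budget
drops by its weight. -/
theorem sum_paths_le {V : Type*} [AddCommGroup V] [Module ℂ V] {D : ℕ} {α : Fin D → Type*}
    [∀ i, Fintype (α i)] (ket : ∀ i, α i → V) (b : ∀ i, α i → V →ₗ[ℂ] ℂ) (w : ∀ i, α i → ℕ) (v : V)
    (φ : V →ₗ[ℂ] ℂ) (L : ℕ) :
    (∑ p : ∀ i, α i, if ∑ i, w i (p i) ≤ L then
      φ (ketAt ket v p 0) * ∏ i, b i (p i) (ketAt ket v p (i + 1)) else 0) =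
    φ ((List.finRange D).foldr (fun i (f : ℕ → V) ℓ =>
      ∑ x, if w i x ≤ ℓ then b i x (f (ℓ - w i x)) • ket i x else 0) (fun _ => v) L) := by
  induction D generalizing φ L with
  | zero => simp [ketAt]
  | succ D ih =>
    rw [List.finRange_succ, List.foldr_cons, List.foldr_map, map_sum,
      ← (Fin.consEquiv α).sum_comp, Fintype.sum_prod_type]
    refine Finset.sum_congr rfl fun x _ => ?_
    have key := ih (fun i => ket i.succ) (fun i => b i.succ) (fun i => w i.succ) (b 0 x)
      (L - w 0 x)
    change (∑ p, if ∑ i, w i ((Fin.cons x p : ∀ i, α i) i) ≤ L then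
      φ (ketAt ket v (Fin.cons x p) 0) * ∏ i, b i ((Fin.cons x p : ∀ i, α i) i)
        (ketAt ket v (Fin.cons x p) (i + 1)) else 0) = _
    simp only [Fin.sum_univ_succ, Fin.prod_univ_succ, Fin.cons_zero,
      Fin.cons_succ, ketAt_cons_zero, Fin.val_zero, Fin.val_succ, ketAt_cons_succ]
    by_cases hx : w 0 x ≤ L
    · rw [if_pos hx, map_smul, ← key, smul_eq_mul, Finset.sum_mul]
      refine Finset.sum_congr rfl fun p _ => ?_
      have : w 0 x + ∑ i : Fin D, w i.succ (p i) ≤ L ↔ ∑ i : Fin D, w i.succ (p i) ≤ L - w 0 x := by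
        omega
      simp only [this, ite_mul, zero_mul]
      congr 1
      ring
    · rw [if_neg hx, map_zero]
      exact Finset.sum_eq_zero fun p _ => if_neg (by omega)

theorem sum_paths {V : Type*} [AddCommGroup V] [Module ℂ V] {D : ℕ} {α : Fin D → Type*}
    [∀ i, Fintype (α i)] (ket : ∀ i, α i → V) (b : ∀ i, α i → V →ₗ[ℂ] ℂ) (v : V)
    (φ : V →ₗ[ℂ] ℂ) :
    ∑ p : ∀ i, α i, φ (ketAt ket v p 0) * ∏ i, b i (p i) (ketAt ket v p (i + 1)) =
    φ ((List.finRange D).foldr (fun i u => ∑ x, b i x u • ket i x) v) := by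
  have h := sum_paths_le ket b (fun _ _ => 0) v φ 0
  simp only [Finset.sum_const_zero, le_refl, if_true, zero_le, Nat.sub_zero] at h
  rw [h]
  congr 1
  induction List.finRange D with
  | nil => rfl
  | cons i l ih => simp only [List.foldr_cons, ih]

/-! ### The truncated sum as a recursion over the layers -/

namespace Ensemble

variable {G : Type*} [Group G] [TopologicalSpace G] {n d D : ℕ}

/-- The layer of a path that consists of a block and two of its components. -/
abbrev Step (C : Ensemble G n d D) (i : Fin D) : Type :=
  (β : Fin (C.B i).numBlocks) × Fin ((C.B i).dim β) × Fin ((C.B i).dim β)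

/-- The noisy matrix coefficient at a node. -/
noncomputable def matCoeff (C : Ensemble G n d D) (g : Fin D → G) (x : C.Node)
    (k' : Fin ((C.B x.1).dim x.2.1)) : ℂ :=
  C.noiseEigenvalue x.1 x.2 * (C.B x.1).coeff x.2.1 (g x.1) x.2.2 k'

/-- Conjugation by a fixed unitary. -/
noncomputable def conjW (C : Ensemble G n d D) (i : Fin D) : QOp n d →ₗ[ℂ] QOp n d :=
  (LinearMap.mulRight ℂ (C.W i : QOp n d)ᴴ).comp (LinearMap.mulLeft ℂ (C.W i : QOp n d))

theorem conjW_apply (C : Ensemble G n d D) (i : Fin D) (X : QOp n d) :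
    C.conjW i X = (C.W i : QOp n d) * X * (C.W i : QOp n d)ᴴ := rfl

/-- The functional by which a layer of a path is multiplied with the rest of the path. -/
noncomputable def stepFunctional (C : Ensemble G n d D) (g : Fin D → G) (i : Fin D) (x : C.Step i) :
    QOp n d →ₗ[ℂ] ℂ :=
  C.matCoeff g ⟨i, x.1, x.2.1⟩ x.2.2 •
    (hsFunctional ((C.B i).T x.1 x.2.2)).comp (C.conjW i)

theorem stepFunctional_apply (C : Ensemble G n d D) (g : Fin D → G) (i : Fin D) (x : C.Step i)
    (X : QOp n d) : C.stepFunctional g i x X =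
      C.matCoeff g ⟨i, x.1, x.2.1⟩ x.2.2 * hsInner ((C.B i).T x.1 x.2.2) (C.conjW i X) := rfl

/-- The trace against an observable. -/
noncomputable def obs (O : QOp n d) : QOp n d →ₗ[ℂ] ℂ :=
  (Matrix.traceLinearMap _ ℂ ℂ).comp (LinearMap.mulLeft ℂ O)

theorem obs_apply (O X : QOp n d) : obs O X = (O * X).trace := rfl

theorem pathWeight_eq [NeZero d] (C : Ensemble G n d D) (O : QOp n d) (p : C.Path) (g : Fin D → G) :
    C.pathWeight O p g = obs O (ketAt (α := C.Step) (fun i x => (C.B i).T x.1 x.2.1)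
      (zeroState n d) p 0) * ∏ i, C.stepFunctional g i (p i)
        (ketAt (α := C.Step) (fun i x => (C.B i).T x.1 x.2.1) (zeroState n d) p (i + 1)) := rfl

open Classical in
/-- The contribution of a layer to the degree of a path. -/
noncomputable def weight (C : Ensemble G n d D) (i : Fin D) (β : Fin (C.B i).numBlocks) : ℕ :=
  if (C.B i).Trivial β then 0 else 1

theorem pathDegree_eq (C : Ensemble G n d D) (p : C.Path) :
    C.pathDegree p = ∑ i, C.weight i (p i).1 := by
  classical
  rw [pathDegree, Finset.card_filter]
  refine Finset.sum_congr rfl fun i _ => ?_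
  by_cases h : (C.B i).Trivial (p i).1 <;> simp [weight, h]

/-- The sum over the paths through `m` layers from layer `i` on, with bounded degree. -/
noncomputable def tail [NeZero d] (C : Ensemble G n d D) (g : Fin D → G) : ℕ → ℕ → ℕ → QOp n d
  | 0, _, _ => zeroState n d
  | m + 1, i, ℓ => if h : i < D then
      ∑ x : C.Step ⟨i, h⟩, if C.weight ⟨i, h⟩ x.1 ≤ ℓ then
        C.stepFunctional g ⟨i, h⟩ x (C.tail g m (i + 1) (ℓ - C.weight ⟨i, h⟩ x.1)) •
          (C.B ⟨i, h⟩).T x.1 x.2.1 else 0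
      else zeroState n d

theorem truncatedMean_eq_obs_tail [NeZero d] (C : Ensemble G n d D) (O : QOp n d) (L : ℕ)
    (g : Fin D → G) : C.truncatedMean O L g = obs O (C.tail g D 0 L) := by
  have h := sum_paths_le (α := C.Step) (fun i x => (C.B i).T x.1 x.2.1) (C.stepFunctional g)
    (fun i x => C.weight i x.1) (zeroState n d) (obs O) L
  rw [truncatedMean]
  simp only [pathDegree_eq, pathWeight_eq]
  rw [h]
  congr 1
  -- The fold over the last `m` layers is compared with the recursion `tail`, which addresses the
  -- layers by natural numbers.
  have key : ∀ m i, i + m = D → ((List.finRange D).drop i).foldr (fun i (f : ℕ → QOp n d) ℓ =>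
      ∑ x : C.Step i, if C.weight i x.1 ≤ ℓ then
        C.stepFunctional g i x (f (ℓ - C.weight i x.1)) • (C.B i).T x.1 x.2.1 else 0)
      (fun _ => zeroState n d) = C.tail g m i := by
    intro m
    induction m with
    | zero =>
      intro i hi
      rw [List.drop_eq_nil_of_le (by simp; omega)]
      rfl
    | succ m ih =>
      intro i hi
      have hiD : i < D := by omega
      rw [List.drop_eq_getElem_cons (by simpa using hiD), List.foldr_cons, ih (i + 1) (by omega)]
      have e : (List.finRange D)[i]'(by simpa using hiD) = ⟨i, hiD⟩ := by simp
      rw [e]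
      funext ℓ
      rw [tail, dif_pos hiD]
  exact congrFun (key D 0 (by omega)) L

/-- The value of the tree below a node, behind the representation of its layer. -/
noncomputable def branch [NeZero d] (C : Ensemble G n d D) (g : Fin D → G) (ℓ : ℕ) (x : C.Node) : ℂ :=
  hsInner ((C.B x.1).op x.2) (C.conjW x.1 (C.tail g (D - 1 - x.1) (x.1 + 1) ℓ))

/-- The value of the tree below a node, including the representation of its layer. -/
noncomputable def fullBranch [NeZero d] (C : Ensemble G n d D) (g : Fin D → G) (ℓ : ℕ) (x : C.Node) :
    ℂ :=
  ∑ k', C.matCoeff g x k' * C.branch g ℓ ⟨x.1, x.2.1, k'⟩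

open Classical in
-- On trivial blocks the noise and the representation act as the identity, so these paths add up to
-- Π₀ applied to the conjugated rest, with unchanged budget. A non-trivial block uses one unit of
-- budget, and its paths add up to the tree below the node.
theorem tail_succ [NeZero d] (C : Ensemble G n d D) {γ : ℝ} (hC : C.NoisePenalised γ)
    (g : Fin D → G) (m : ℕ) (i : Fin D) (hi : i + m + 1 = D) (ℓ : ℕ) :
    C.tail g (m + 1) i ℓ = (C.B i).projTrivial (C.conjW i (C.tail g m (i + 1) ℓ)) +
      ∑ a : (C.B i).Label, if (C.B i).Trivial a.1 then 0 else
        if ℓ = 0 then 0 else C.fullBranch g (ℓ - 1) ⟨i, a⟩ • (C.B i).op a := by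
  rw [tail, dif_pos i.2, ITOBasis.projTrivial, ← Finset.sum_add_distrib, Fintype.sum_sigma,
    Fintype.sum_sigma]
  refine Finset.sum_congr rfl fun β _ => ?_
  rw [Fintype.sum_prod_type]
  refine Finset.sum_congr rfl fun k _ => ?_
  simp only [stepFunctional_apply, weight]
  by_cases h : (C.B i).Trivial β
  · simp only [Fin.eta, h, if_true, zero_le, Nat.sub_zero, add_zero, matCoeff,
      ITOBasis.coeff_of_trivial _ h]
    rw [hC.fixes_trivial i ⟨β, k⟩ h, Finset.sum_eq_single k]
    · simp [ITOBasis.op]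
    · intro k' _ hk; simp [hk.symm]
    · simp
  · simp only [Fin.eta, h, if_false, zero_add]
    by_cases hl : ℓ = 0
    · simp [hl]
    · have hm : D - 1 - i = m := by omega
      simp only [hl, if_false, Nat.one_le_iff_ne_zero.2 hl, if_true, fullBranch, branch, hm,
        Finset.sum_smul]
      rfl

end Ensemble

/-! ### Unrolling the trivial layers into a tree -/

namespace Ensemble

variable {G : Type*} [Group G] [TopologicalSpace G] {n d D : ℕ}

theorem hop_val (C : Ensemble G n d D) (i : Fin D) (X : QOp n d) : C.hop i X = C.conjW i X :=
  dif_pos i.2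

theorem proj_val (C : Ensemble G n d D) (i : Fin D) (X : QOp n d) :
    C.proj i X = (C.B i).projTrivial X := dif_pos i.2

theorem isLinearMap_hop (C : Ensemble G n d D) (m : ℕ) : IsLinearMap ℂ (C.hop m) := by
  by_cases h : m < D
  · have e : C.hop m = C.conjW ⟨m, h⟩ := funext fun X => C.hop_val ⟨m, h⟩ X
    rw [e]; exact (C.conjW ⟨m, h⟩).isLinear
  · have e : C.hop m = LinearMap.id (R := ℂ) := funext fun X => dif_neg h
    rw [e]; exact LinearMap.id.isLinear

theorem isLinearMap_proj (C : Ensemble G n d D) (m : ℕ) : IsLinearMap ℂ (C.proj m) := by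
  classical
  by_cases h : m < D
  · have e : C.proj m = (∑ a : (C.B ⟨m, h⟩).Label, if (C.B ⟨m, h⟩).Trivial a.1 then
        (hsFunctional ((C.B ⟨m, h⟩).op a)).smulRight ((C.B ⟨m, h⟩).op a) else 0 :
        QOp n d →ₗ[ℂ] QOp n d) := by
      funext X
      rw [C.proj_val ⟨m, h⟩, ITOBasis.projTrivial, LinearMap.sum_apply]
      refine Finset.sum_congr rfl fun a _ => ?_
      split_ifs <;> rfl
    rw [e]; exact LinearMap.isLinear _
  · have e : C.proj m = LinearMap.id (R := ℂ) := funext fun X => dif_neg h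
    rw [e]; exact LinearMap.id.isLinear

theorem isLinearMap_segment (C : Ensemble G n d D) (i m : ℕ) : IsLinearMap ℂ (C.segment i m) := by
  induction m generalizing i with
  | zero => exact C.isLinearMap_hop i
  | succ m ih =>
    exact (((C.isLinearMap_hop i).mk' _).comp
      (((C.isLinearMap_proj (i + 1)).mk' _).comp ((ih (i + 1)).mk' _))).isLinear

/-- The definition of `segment` unfolds at its first layer, whereas a path that stays trivial
extends the segment at its last layer. -/
theorem segment_succ' (C : Ensemble G n d D) (i m : ℕ) (X : QOp n d) :
    C.segment i (m + 1) X = C.segment i m (C.proj (i + m + 1) (C.hop (i + m + 1) X)) := by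
  induction m generalizing i with
  | zero => rfl
  | succ m ih =>
    rw [segment, ih (i + 1), segment, show i + 1 + m + 1 = i + (m + 1) + 1 by omega]

/-- The contraction of a node, as a functional. -/
noncomputable def segmentFunctional (C : Ensemble G n d D) (x : C.Node) (m : ℕ) : QOp n d →ₗ[ℂ] ℂ :=
  (hsFunctional ((C.B x.1).op x.2)).comp ((C.isLinearMap_segment x.1 m).mk' _)

theorem segmentFunctional_apply (C : Ensemble G n d D) (x : C.Node) (m : ℕ) (X : QOp n d) :
    C.segmentFunctional x m X = hsInner ((C.B x.1).op x.2) (C.segment x.1 m X) := rfl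

theorem segmentFunctional_succ (C : Ensemble G n d D) (x : C.Node) (m : ℕ) (X : QOp n d) (j : Fin D)
    (hj : (j : ℕ) = x.1 + m + 1) : C.segmentFunctional x (m + 1) X =
      C.segmentFunctional x m ((C.B j).projTrivial (C.conjW j X)) := by
  rw [segmentFunctional_apply, segmentFunctional_apply, segment_succ', ← hj, hop_val, proj_val]

open Classical in
-- After `k` trivial layers a path is either trivial at the next layer, which lengthens the segment
-- by one, or leaves the segment there at a non-trivial node, with the contraction as its factor.
-- Iterating to the last layer leaves the end contraction and one term for each exit. The induction
-- is on the number `m` of layers left.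
theorem segmentFunctional_tail [NeZero d] (C : Ensemble G n d D) {γ : ℝ} (hC : C.NoisePenalised γ)
    (g : Fin D → G) (x : C.Node) (ℓ m k : ℕ) (h : x.1 + k + 1 + m = D) :
    C.segmentFunctional x k (C.tail g m (x.1 + k + 1) ℓ) = C.endContraction x (zeroState n d) +
      ∑ j : Fin D, if x.1 + k < j then ∑ a : (C.B j).Label, (if (C.B j).Trivial a.1 then 0 else
        if ℓ = 0 then 0 else C.fullBranch g (ℓ - 1) ⟨j, a⟩ * C.contraction x ⟨j, a⟩) else 0 := by
  induction m generalizing k with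
  | zero =>
    rw [Finset.sum_eq_zero fun j _ => if_neg (by omega), add_zero, endContraction,
      segmentFunctional_apply, tail, show D - 1 - x.1 = k by omega]
  | succ m ih =>
    obtain ⟨j, hj⟩ : ∃ j : Fin D, (j : ℕ) = x.1 + k + 1 := ⟨⟨x.1 + k + 1, by omega⟩, rfl⟩
    -- The layer `j` immediately after the segment is split off; the later layers belong to the
    -- induction hypothesis.
    have hsplit : ∀ (S : Fin D → ℂ) (i : Fin D), (if x.1 + k < i then S i else 0) =
        (if i = j then S i else 0) + if x.1 + (k + 1) < i then S i else 0 := by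
      intro S i
      by_cases hij : i = j
      · subst hij
        rw [if_pos (by omega), if_pos rfl, if_neg (by omega), add_zero]
      · have : (i : ℕ) ≠ j := fun e => hij (Fin.ext e)
        rw [if_neg hij, zero_add]
        exact if_congr (by omega) rfl rfl
    have ih' := ih (k + 1) (by omega)
    rw [Finset.sum_congr rfl fun i _ => hsplit (fun j => ∑ a : (C.B j).Label,
        (if (C.B j).Trivial a.1 then 0 else if ℓ = 0 then 0 else
          C.fullBranch g (ℓ - 1) ⟨j, a⟩ * C.contraction x ⟨j, a⟩)) i,
      Finset.sum_add_distrib, Finset.sum_ite_eq' Finset.univ j, if_pos (Finset.mem_univ j),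
      ← add_assoc, add_right_comm (C.endContraction x _), ← ih', ← hj, C.tail_succ hC g m j (by omega), map_add, hj,
      ← C.segmentFunctional_succ x k _ j hj]
    rw [show x.1 + k + 1 + 1 = x.1 + (k + 1) + 1 by omega, map_sum]
    congr 1
    refine Finset.sum_congr rfl fun a _ => ?_
    split_ifs
    · exact map_zero _
    · exact map_zero _
    · rw [map_smul, smul_eq_mul, contraction, segmentFunctional_apply]
      simp only [show (j : ℕ) - x.1 - 1 = k by omega]

theorem branch_eq_segmentFunctional [NeZero d] (C : Ensemble G n d D) (g : Fin D → G) (ℓ : ℕ)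
    (x : C.Node) : C.branch g ℓ x =
      C.segmentFunctional x 0 (C.tail g (D - 1 - x.1) (x.1 + 0 + 1) ℓ) := by
  rw [segmentFunctional_apply, segment, hop_val]; rfl

theorem branch_zero [NeZero d] (C : Ensemble G n d D) {γ : ℝ} (hC : C.NoisePenalised γ)
    (g : Fin D → G) (x : C.Node) : C.branch g 0 x = C.endContraction x (zeroState n d) := by
  rw [branch_eq_segmentFunctional, C.segmentFunctional_tail hC g x 0 _ 0 (by omega)]
  simp

theorem branch_succ [NeZero d] (C : Ensemble G n d D) {γ : ℝ} (hC : C.NoisePenalised γ)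
    (g : Fin D → G) (ℓ : ℕ) (x : C.Node) : C.branch g (ℓ + 1) x =
      C.endContraction x (zeroState n d) +
        ∑ z ∈ C.exits x, C.contraction x z * C.fullBranch g ℓ z := by
  classical
  rw [branch_eq_segmentFunctional, C.segmentFunctional_tail hC g x (ℓ + 1) _ 0 (by omega)]
  congr 1
  rw [exits, Finset.sum_filter, Fintype.sum_sigma]
  refine Finset.sum_congr rfl fun j _ => ?_
  by_cases hj : x.1 < j
  · rw [if_pos (by simpa using hj)]
    refine Finset.sum_congr rfl fun a _ => ?_
    by_cases ha : (C.B j).Trivial a.1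
    · simp [ha]
    · by_cases hz : C.contraction x ⟨j, a⟩ = 0
      · simp [hz]
      · simp [hj, ha, hz, mul_comm]
  · rw [if_neg (by simpa using hj)]
    exact (Finset.sum_eq_zero fun a _ => if_neg fun h => hj h.1).symm

open Classical in
-- As `O` is Hermitian, tr(O T) is the complex conjugate of tr(T† O), so the operators outside the
-- support have coefficient zero. A non-trivial root already consumes one unit of budget, and with
-- budget zero it contributes nothing.
theorem truncatedMean_eq_sum_support [NeZero d] [NeZero D] (C : Ensemble G n d D) {γ : ℝ}
    (hC : C.NoisePenalised γ) {O : QOp n d} (hO : O.IsHermitian) (L : ℕ) (g : Fin D → G) :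
    C.truncatedMean O L g = ∑ a ∈ (C.B 0).support O, (O * (C.B 0).op a).trace *
      if (C.B 0).Trivial a.1 then C.branch g L ⟨0, a⟩ else
        if L = 0 then 0 else C.fullBranch g (L - 1) ⟨0, a⟩ := by
  obtain ⟨D, rfl⟩ : ∃ D', D = D' + 1 := ⟨D - 1, (Nat.succ_pred (NeZero.ne D)).symm⟩
  have h0 := C.tail_succ hC g D 0 (by simp) L
  rw [Fin.val_zero] at h0
  rw [truncatedMean_eq_obs_tail, h0, ITOBasis.projTrivial, ← Finset.sum_add_distrib, map_sum,
    ITOBasis.support, Finset.sum_filter]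
  refine Finset.sum_congr rfl fun a _ => ?_
  have hsym : hsInner ((C.B 0).op a) O = star (O * (C.B 0).op a).trace := by
    rw [← hsInner_of_isHermitian hO, star_hsInner]
  by_cases ha : (O * (C.B 0).op a).trace = 0
  · rw [if_neg (show ¬ hsInner ((C.B 0).op a) O ≠ 0 by simp [hsym, ha]), map_add]
    split_ifs <;> simp [obs_apply, ha]
  · rw [if_pos (show hsInner ((C.B 0).op a) O ≠ 0 by simp [hsym, ha]), map_add]
    have hb : C.branch g L ⟨0, a⟩ =
      hsInner ((C.B 0).op a) (C.conjW 0 (C.tail g D (0 + 1) L)) := by rw [branch]; simp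
    split_ifs <;> simp [obs_apply, hb, mul_comm]

/-! ### Every node has a term -/

open Classical in
-- If a node had no term, its functional would vanish at the end of the circuit. Going back one
-- layer, it vanishes on the trivial subspace by the previous step and on the non-trivial basis
-- operators because there are no exits. At the node's own layer this contradicts ⟨⟨T|T⟩⟩ = 1.
-- Consequently `s` is positive as soon as there is a node.
theorem one_le_contractionRank (C : Ensemble G n d D) (x : C.Node) : 1 ≤ C.contractionRank x := by
  by_contra hlt
  rw [contractionRank] at hlt
  have hs : ¬ C.Survives x := fun h => hlt (by rw [if_pos h]; omega)
  have he : C.exits x = ∅ := by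
    rw [← Finset.card_eq_zero]; omega
  have hex : ∀ y : C.Node, x.1 < y.1 → ¬ (C.B y.1).Trivial y.2.1 → C.contraction x y = 0 := by
    intro y h1 h2
    by_contra h3
    have : y ∈ C.exits x := by rw [exits, Finset.mem_filter]; exact ⟨Finset.mem_univ _, h1, h2, h3⟩
    rw [he] at this
    exact Finset.notMem_empty _ this
  have key : ∀ m k, x.1 + k + 1 + m = D → ∀ X, C.segmentFunctional x k X = 0 := by
    intro m
    induction m with
    | zero =>
      intro k hk X
      by_contra h
      refine hs ⟨X, ?_⟩
      rwa [endContraction, show D - 1 - x.1 = k by omega]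
    | succ m ih =>
      intro k hk X
      obtain ⟨j, hj⟩ : ∃ j : Fin D, (j : ℕ) = x.1 + k + 1 := ⟨⟨x.1 + k + 1, by omega⟩, rfl⟩
      -- Undoing the conjugation by the unitary of layer `j` makes the longer functional equal to
      -- the shorter one on the projection of `X` itself.
      have h1 := ih (k + 1) (by omega) ((C.W j : QOp n d)ᴴ * X * (C.W j : QOp n d))
      have hW : C.conjW j ((C.W j : QOp n d)ᴴ * X * (C.W j : QOp n d)) = X := by
        have hu : (C.W j : QOp n d) * (C.W j : QOp n d)ᴴ = 1 :=
          Matrix.mem_unitaryGroup_iff.1 (C.W j).2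
        rw [conjW_apply, Matrix.mul_assoc, Matrix.mul_assoc, Matrix.mul_assoc, hu, Matrix.mul_one,
          ← Matrix.mul_assoc, hu, Matrix.one_mul]
      rw [C.segmentFunctional_succ x k _ j hj, hW, ITOBasis.projTrivial, map_sum] at h1
      rw [← (C.B j).sum_hsInner_smul_op X, map_sum, ← h1]
      refine Finset.sum_congr rfl fun a _ => ?_
      split_ifs with ha
      · rfl
      · have := hex ⟨j, a⟩ (Fin.lt_def.2 (by simp only []; omega)) ha
        rw [contraction] at this
        simp only [show (j : ℕ) - x.1 - 1 = k by omega] at this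
        rw [map_smul, map_zero, segmentFunctional_apply, this, smul_zero]
  have hx := key (D - 1 - x.1) 0 (by omega)
    ((C.W x.1 : QOp n d)ᴴ * (C.B x.1).op x.2 * (C.W x.1 : QOp n d))
  have hu : (C.W x.1 : QOp n d) * (C.W x.1 : QOp n d)ᴴ = 1 :=
    Matrix.mem_unitaryGroup_iff.1 (C.W x.1).2
  rw [segmentFunctional_apply, segment, hop_val, conjW_apply, Matrix.mul_assoc, Matrix.mul_assoc,
    Matrix.mul_assoc, hu, Matrix.mul_one, ← Matrix.mul_assoc, hu, Matrix.one_mul,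
    ITOBasis.hsInner_op, if_pos rfl] at hx
  exact one_ne_zero hx

end Ensemble

/-! ### Tasks of the program, their values and their time bounds -/

namespace Ensemble

variable {G : Type*} [Group G] [TopologicalSpace G] {n d D : ℕ}

theorem block?_val (C : Ensemble G n d D) (i : Fin D) (β : Fin (C.B i).numBlocks) :
    C.block? i β = some ⟨i, β⟩ := by
  simp [block?, layer?]

theorem node?_val (C : Ensemble G n d D) (x : C.Node) :
    C.node? x.1 x.2.1 x.2.2 = some x := by
  simp [node?, block?_val]

open Classical in
theorem length_terms (C : Ensemble G n d D) (x : C.Node) :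
    (C.terms x).length = C.contractionRank x := by
  rw [terms, contractionRank]
  split_ifs <;> simp

/-- The value of a term of a contraction. -/
noncomputable def termValue [NeZero d] (C : Ensemble G n d D) (g : Fin D → G) (ℓ : ℕ) (x : C.Node) :
    Option C.Node → ℂ
  | some y => C.contraction x y * C.fullBranch g ℓ y
  | none => C.endContraction x (zeroState n d)

/-- The end of the circuit is listed only if its functional is non-zero; otherwise the overlap in
the recursion vanishes, and nothing is lost. -/
theorem sum_terms [NeZero d] (C : Ensemble G n d D) {γ : ℝ} (hC : C.NoisePenalised γ)
    (g : Fin D → G) (ℓ : ℕ) (x : C.Node) :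
    ((C.terms x).map (C.termValue g ℓ x)).sum = C.branch g (ℓ + 1) x := by
  classical
  rw [C.branch_succ hC, terms, List.map_append, List.sum_append, List.map_map, add_comm]
  congr 1
  · by_cases h : C.Survives x
    · simp [h, termValue]
    · simp only [h, if_false, List.map_nil, List.sum_nil]
      by_contra h0
      exact h ⟨_, fun e => h0 e.symm⟩
  · rw [← Finset.sum_map_toList]
    rfl

/-- Pending tasks of the evaluation. -/
inductive Task (C : Ensemble G n d D)
  | root (q : ℕ)
  | con (x : C.Node) (ℓ q : ℕ) (c : ℂ)
  | mat (x : C.Node) (ℓ q : ℕ) (hq : q ≤ (C.B x.1).dim x.2.1) (c : ℂ)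

namespace Task

variable {C : Ensemble G n d D}

/-- The record of a task. -/
def enc (L : ℕ) : C.Task → Rec
  | root q => ⟨0, L, 0, 0, 0, q, 0⟩
  | con x ℓ q c => ⟨1, ℓ, x.1, x.2.1, x.2.2, q, c⟩
  | mat x ℓ q _ c => ⟨2, ℓ, x.1, x.2.1, x.2.2, q, c⟩

open Classical in
/-- The value of a basis operator in the expansion of the observable. -/
noncomputable def rootValue [NeZero d] [NeZero D] (C : Ensemble G n d D) (O : QOp n d) (L : ℕ)
    (g : Fin D → G) (a : (C.B 0).Label) : ℂ :=
  (O * (C.B 0).op a).trace * if (C.B 0).Trivial a.1 then C.branch g L ⟨0, a⟩ else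
    if L = 0 then 0 else C.fullBranch g (L - 1) ⟨0, a⟩

/-- The contribution of a task to the result. -/
noncomputable def value [NeZero d] [NeZero D] (O : QOp n d) (L : ℕ) (g : Fin D → G) : C.Task → ℂ
  | root q => ((((C.B 0).support O).toList.drop q).map (rootValue C O L g)).sum
  | con x 0 _ c => c * C.endContraction x (zeroState n d)
  | con x (ℓ + 1) q c => c * (((C.terms x).drop q).map (C.termValue g ℓ x)).sum
  | mat x ℓ q _ c => c * ∑ k' : Fin ((C.B x.1).dim x.2.1), if (k' : ℕ) < q then
      C.matCoeff g x k' * C.branch g ℓ ⟨x.1, x.2.1, k'⟩ else 0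

/-- A bound for the time below a node, behind the representation of its layer. -/
def nodeTime (cost : Costs) (p ℓ : ℕ) : ℕ :=
  104 * (p ^ ℓ * (ℓ * (3 * cost.contract + cost.matrixCoeff) + cost.overlap))

/-- A bound for the time for `q` components of a block. -/
def blockTime (cost : Costs) (p ℓ q : ℕ) : ℕ :=
  104 + q * (104 * cost.matrixCoeff + nodeTime cost p ℓ)

/-- A bound for the time that a task takes. -/
noncomputable def time (cost : Costs) (s m r L : ℕ) : C.Task → ℕ
  | root q => 104 + (r - q) * (104 + nodeTime cost (s * m) L)
  | con _ 0 _ _ => 104 * cost.overlap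
  | con x (ℓ + 1) q _ => 104 * cost.contract +
      ((C.terms x).length - q) * (104 * cost.contract + blockTime cost (s * m) ℓ m)
  | mat _ ℓ q _ _ => blockTime cost (s * m) ℓ q

theorem overlap_le_nodeTime (cost : Costs) {p : ℕ} (hp : 1 ≤ p) (ℓ : ℕ) :
    104 * cost.overlap ≤ nodeTime cost p ℓ := by
  refine Nat.mul_le_mul_left _ ?_
  calc cost.overlap ≤ 1 * (ℓ * (3 * cost.contract + cost.matrixCoeff) + cost.overlap) := by
        rw [one_mul]; exact Nat.le_add_left _ _
    _ ≤ _ := Nat.mul_le_mul_right _ (Nat.one_le_pow _ _ hp)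

/-- This is the recursion for the time bounds. The factor 3 in `nodeTime` pays for the unsuccessful
call at the end of a list of terms, for up to `s` successful calls, and for closing up to `s`
blocks; each of these is at most s·m contractions. The unit 104 covers 100 instructions, up to three
unit-cost calls and the loop test. -/
theorem terms_le_nodeTime (cost : Costs) {s m : ℕ} (hs : 1 ≤ s) (hm : 1 ≤ m) (ℓ : ℕ) :
    104 * cost.contract + s * (104 * cost.contract + blockTime cost (s * m) ℓ m) ≤
      nodeTime cost (s * m) (ℓ + 1) := by
  have ha := cost.contract_pos
  have hp : 1 ≤ s * m := Nat.mul_pos hs hm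
  have e : nodeTime cost (s * m) (ℓ + 1) = s * m * nodeTime cost (s * m) ℓ +
      104 * ((s * m) ^ (ℓ + 1) * (3 * cost.contract + cost.matrixCoeff)) := by
    rw [nodeTime, nodeTime, pow_succ]; ring
  have h1 : s * m * (3 * cost.contract + cost.matrixCoeff) ≤
      (s * m) ^ (ℓ + 1) * (3 * cost.contract + cost.matrixCoeff) :=
    Nat.mul_le_mul_right _ (Nat.le_self_pow (Nat.succ_ne_zero _) _)
  have h2 : cost.contract ≤ s * m * cost.contract := Nat.le_mul_of_pos_left _ hp
  have h3 : s * cost.contract ≤ s * m * cost.contract :=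
    Nat.mul_le_mul_right _ (Nat.le_mul_of_pos_right _ hm)
  have h4 : s ≤ s * cost.contract := Nat.le_mul_of_pos_right _ ha
  have e2 : s * (104 * cost.contract + blockTime cost (s * m) ℓ m) =
      104 * (s * cost.contract) + 104 * s + 104 * (s * m * cost.matrixCoeff) +
        s * m * nodeTime cost (s * m) ℓ := by
    rw [blockTime]; ring
  have e3 : s * m * (3 * cost.contract + cost.matrixCoeff) =
      3 * (s * m * cost.contract) + s * m * cost.matrixCoeff := by ring
  rw [e, e2]
  omega

theorem time_con_le (cost : Costs) {s m : ℕ} (hs : 1 ≤ s) (hm : 1 ≤ m)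
    (hC : ∀ x, C.contractionRank x ≤ s) (r L : ℕ) (x : C.Node) (ℓ q : ℕ) (c : ℂ) :
    time cost s m r L (con x ℓ q c) ≤ nodeTime cost (s * m) ℓ := by
  cases ℓ with
  | zero => exact overlap_le_nodeTime cost (Nat.mul_pos hs hm) 0
  | succ ℓ =>
    refine le_trans ?_ (terms_le_nodeTime cost hs hm ℓ)
    refine Nat.add_le_add_left (Nat.mul_le_mul_right _ ?_) _
    rw [length_terms]
    exact (Nat.sub_le _ _).trans (hC x)

theorem blockTime_mono (cost : Costs) (p ℓ : ℕ) {q q' : ℕ} (h : q ≤ q') :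
    blockTime cost p ℓ q ≤ blockTime cost p ℓ q' :=
  Nat.add_le_add_left (Nat.mul_le_mul_right _ h) _

theorem handle_con [NeZero d] [NeZero D] {s m : ℕ} (hs : 1 ≤ s)
    (hm : 1 ≤ m) (hm' : ∀ i β, (C.B i).dim β ≤ m)
    (O : QOp n d) (L : ℕ) (g : Fin D → G) (cost : Costs) (x : C.Node) (ℓ q : ℕ) (c : ℂ)
    (l : List Rec) (σ : State) (acc : ℂ) (hσ : Pending σ ((con x ℓ q c).enc L :: l) acc) :
    ∃ (τ : State) (t : ℕ) (ws : List C.Task) (u : ℂ),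
      Runs (C.subroutines O g) cost.ofSub handle σ τ t ∧
      Pending τ (ws.map (enc L) ++ l) (acc + u) ∧
      t + 1 + (ws.map (time cost s m ((C.B 0).rank O) L)).sum ≤
        time cost s m ((C.B 0).rank O) L (con x ℓ q c) ∧
      (con x ℓ q c).value O L g = u + (ws.map (value O L g)).sum := by
  have ha := cost.contract_pos
  have hov : ∀ q, C.subroutines O g .overlap x.1 x.2.1 x.2.2 q =
      (0, C.endContraction x (zeroState n d)) := fun q => by
    simp [subroutines, node?_val]
  cases ℓ with
  | zero =>
    obtain ⟨τ, t, hr, ht, hτ⟩ := handle_con_leaf (cost := cost.ofSub) (hov q) hσ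
    refine ⟨τ, t, [], _, hr, hτ, ?_, ?_⟩
    · have := cost.overlap_pos
      simp only [Costs.ofSub] at ht
      simp only [List.map_nil, List.sum_nil, time]
      omega
    · simp [value]
  | succ ℓ =>
    cases hq : (C.terms x)[q]? with
    | none =>
      have hv : C.subroutines O g .contract x.1 x.2.1 x.2.2 q = (0, 0) := by
        simp [subroutines, node?_val, hq]
      obtain ⟨τ, t, hr, ht, hτ⟩ := handle_con_nil (cost := cost.ofSub) hv hσ
      refine ⟨τ, t, [], 0, hr, by simpa using hτ, ?_, ?_⟩
      · simp only [Costs.ofSub] at ht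
        simp only [List.map_nil, List.sum_nil, time]
        omega
      · simp [value, List.drop_eq_nil_of_le (List.getElem?_eq_none_iff.1 hq)]
    | some y =>
      obtain ⟨hlt, hy⟩ := List.getElem?_eq_some_iff.1 hq
      have hlen : (C.terms x).length - q = (C.terms x).length - (q + 1) + 1 := by omega
      cases y with
      | none =>
        have hu : C.subroutines O g .contract x.1 x.2.1 x.2.2 q = (![2, 0, 0, 0], 0) := by
          simp [subroutines, node?_val, hq]
        obtain ⟨τ, t, hr, ht, hτ⟩ := handle_con_end (cost := cost.ofSub) hu (hov q) hσ
        refine ⟨τ, t, [con x (ℓ + 1) (q + 1) c], _, hr, hτ, ?_, ?_⟩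
        -- The end of the circuit is charged like a block with a single component, which costs at
        -- least one overlap and is covered by the allowance for `m` components.
        · have h1 := overlap_le_nodeTime cost (Nat.mul_pos hs hm) ℓ
          have h2 := blockTime_mono cost (s * m) ℓ hm
          have h3 : 104 + nodeTime cost (s * m) ℓ ≤ blockTime cost (s * m) ℓ 1 := by
            rw [blockTime]; omega
          simp only [Costs.ofSub] at ht
          simp only [List.map_cons, List.map_nil, List.sum_cons, List.sum_nil, time]
          rw [hlen, Nat.add_mul, Nat.one_mul]
          omega
        · simp [value, List.drop_eq_getElem_cons hlt, hy, termValue, mul_add]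
      | some y =>
        have hu : C.subroutines O g .contract x.1 x.2.1 x.2.2 q =
            (![1, (y.1 : ℕ), y.2.1, y.2.2], C.contraction x y) := by
          simp [subroutines, node?_val, hq]
        have hv : ∀ a b, C.subroutines O g .dim y.1 y.2.1 a b =
            (![(C.B y.1).dim y.2.1, 0, 0, 0], 0) := fun a b => by
          simp [subroutines, block?_val]
        obtain ⟨τ, t, hr, ht, hτ⟩ := handle_con_node (cost := cost.ofSub) hu hv hσ
        refine ⟨τ, t, [mat y ℓ _ le_rfl (c * C.contraction x y), con x (ℓ + 1) (q + 1) c], 0, hr,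
          by rw [add_zero]; exact hτ, ?_, ?_⟩
        · have h2 := blockTime_mono cost (s * m) ℓ (hm' y.1 y.2.1)
          simp only [Costs.ofSub] at ht
          simp only [List.map_cons, List.map_nil, List.sum_cons, List.sum_nil, time]
          rw [hlen, Nat.add_mul, Nat.one_mul]
          omega
        · simp [value, List.drop_eq_getElem_cons hlt, hy, termValue, mul_add, fullBranch, mul_assoc]

theorem handle_mat [NeZero d] [NeZero D] {s m : ℕ} (hs : 1 ≤ s)
    (hm : 1 ≤ m) (hr : ∀ x, C.contractionRank x ≤ s) {γ : ℝ} (hC : C.NoisePenalised γ)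
    (O : QOp n d) (L : ℕ) (g : Fin D → G) (cost : Costs) (x : C.Node) (ℓ q : ℕ)
    (hq : q ≤ (C.B x.1).dim x.2.1) (c : ℂ)
    (l : List Rec) (σ : State) (acc : ℂ) (hσ : Pending σ ((mat x ℓ q hq c).enc L :: l) acc) :
    ∃ (τ : State) (t : ℕ) (ws : List C.Task) (u : ℂ),
      Runs (C.subroutines O g) cost.ofSub handle σ τ t ∧
      Pending τ (ws.map (enc L) ++ l) (acc + u) ∧
      t + 1 + (ws.map (time cost s m ((C.B 0).rank O) L)).sum ≤
        time cost s m ((C.B 0).rank O) L (mat x ℓ q hq c) ∧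
      (mat x ℓ q hq c).value O L g = u + (ws.map (value O L g)).sum := by
  cases q with
  | zero =>
    obtain ⟨τ, t, hr, ht, hτ⟩ := handle_mat_zero (val := C.subroutines O g) (cost := cost.ofSub) hσ
    refine ⟨τ, t, [], 0, hr, by simpa using hτ, ?_, ?_⟩
    · simp only [List.map_nil, List.sum_nil, time, blockTime]
      omega
    · simp [value]
  | succ q =>
    have hv : C.subroutines O g .matrixCoeff x.1 x.2.1 x.2.2 q = (0, C.matCoeff g x ⟨q, hq⟩) := by
      have : q < (C.B x.1).dim x.2.1 := hq
      simp [subroutines, node?_val, this, matCoeff]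
    obtain ⟨τ, t, hrun, ht, hτ⟩ := handle_mat_succ (cost := cost.ofSub) hv hσ
    refine ⟨τ, t, [con ⟨x.1, x.2.1, ⟨q, hq⟩⟩ ℓ 0 (c * C.matCoeff g x ⟨q, hq⟩),
      mat x ℓ q (Nat.le_of_succ_le hq) c], 0, hrun, by rw [add_zero]; exact hτ, ?_, ?_⟩
    · have h1 := time_con_le cost hs hm hr ((C.B 0).rank O) L ⟨x.1, x.2.1, ⟨q, hq⟩⟩ ℓ 0
        (c * C.matCoeff g x ⟨q, hq⟩)
      have h2 := cost.matrixCoeff_pos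
      simp only [Costs.ofSub] at ht
      simp only [List.map_cons, List.map_nil, List.sum_cons, List.sum_nil]
      have h3 : time cost s m ((C.B 0).rank O) L (mat x ℓ (q + 1) hq c) =
          time cost s m ((C.B 0).rank O) L (mat x ℓ q (Nat.le_of_succ_le hq) c) +
            (104 * cost.matrixCoeff + nodeTime cost (s * m) ℓ) := by
        simp only [time, blockTime]; ring
      omega
    -- A contraction task that starts at position 0 is worth its factor times the whole tree below
    -- the node; with budget zero this is the overlap alone.
    · have hcon : (con ⟨x.1, x.2.1, ⟨q, hq⟩⟩ ℓ 0 (c * C.matCoeff g x ⟨q, hq⟩)).value O L g =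
          c * (C.matCoeff g x ⟨q, hq⟩ * C.branch g ℓ ⟨x.1, x.2.1, ⟨q, hq⟩⟩) := by
        rw [← mul_assoc]
        cases ℓ with
        | zero => rw [C.branch_zero hC]; rfl
        | succ ℓ => rw [← C.sum_terms hC]; rfl
      simp only [List.map_cons, List.map_nil, List.sum_cons, List.sum_nil, hcon]
      simp only [value]
      rw [zero_add, add_zero, ← mul_add]
      congr 1
      have : ∀ k' : Fin ((C.B x.1).dim x.2.1), (if (k' : ℕ) < q + 1 then
          C.matCoeff g x k' * C.branch g ℓ ⟨x.1, x.2.1, k'⟩ else 0) =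
          (if k' = ⟨q, hq⟩ then C.matCoeff g x k' * C.branch g ℓ ⟨x.1, x.2.1, k'⟩ else 0) +
          if (k' : ℕ) < q then C.matCoeff g x k' * C.branch g ℓ ⟨x.1, x.2.1, k'⟩ else 0 := by
        intro k'
        by_cases h : k' = ⟨q, hq⟩
        · subst h; simp
        · have : (k' : ℕ) ≠ q := fun e => h (Fin.ext e)
          rw [if_neg h, zero_add]
          exact if_congr (by omega) rfl rfl
      rw [Finset.sum_congr rfl fun k' _ => this k', Finset.sum_add_distrib, Finset.sum_ite_eq',
        if_pos (Finset.mem_univ _)]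

theorem handle_root [NeZero d] [NeZero D] {s m : ℕ} (hs : 1 ≤ s)
    (hm : 1 ≤ m) (hm' : ∀ i β, (C.B i).dim β ≤ m)
    (hr : ∀ x, C.contractionRank x ≤ s) {γ : ℝ} (hC : C.NoisePenalised γ)
    (O : QOp n d) (L : ℕ) (g : Fin D → G) (cost : Costs) (q : ℕ)
    (l : List Rec) (σ : State) (acc : ℂ) (hσ : Pending σ ((root q : C.Task).enc L :: l) acc) :
    ∃ (τ : State) (t : ℕ) (ws : List C.Task) (u : ℂ),
      Runs (C.subroutines O g) cost.ofSub handle σ τ t ∧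
      Pending τ (ws.map (enc L) ++ l) (acc + u) ∧
      t + 1 + (ws.map (time cost s m ((C.B 0).rank O) L)).sum ≤
        time cost s m ((C.B 0).rank O) L (root q : C.Task) ∧
      (root q : C.Task).value O L g = u + (ws.map (value O L g)).sum := by
  classical
  cases hq : ((C.B 0).support O).toList[q]? with
  | none =>
    have hv : ∀ x y z, C.subroutines O g .root q x y z = (0, 0) := fun x y z => by
      simp [subroutines, hq]
    obtain ⟨τ, t, hr, ht, hτ⟩ := handle_root_nil (cost := cost.ofSub) hv hσ
    refine ⟨τ, t, [], 0, hr, by simpa using hτ, ?_, ?_⟩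
    · simp only [Costs.ofSub] at ht
      simp only [List.map_nil, List.sum_nil, time]
      omega
    · simp only [value, List.drop_eq_nil_of_le (List.getElem?_eq_none_iff.1 hq)]
      simp
  | some a =>
    obtain ⟨hlt, ha⟩ := List.getElem?_eq_some_iff.1 hq
    have hlen : (C.B 0).rank O - q = (C.B 0).rank O - (q + 1) + 1 := by
      rw [Finset.length_toList] at hlt
      rw [ITOBasis.rank]
      omega
    have h0 : ((0 : Fin D) : ℕ) = 0 := by simp
    have hu : ∀ x y z, C.subroutines O g .root q x y z =
        (![1, (a.1 : ℕ), a.2, 0], (O * (C.B 0).op a).trace) := fun x y z => by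
      simp [subroutines, hq]
    have hb : C.block? 0 a.1 = some ⟨0, a.1⟩ := by
      have := C.block?_val 0 a.1
      rwa [h0] at this
    have hval : (root q : C.Task).value O L g =
        rootValue C O L g a + (root (q + 1) : C.Task).value O L g := by
      simp only [value, List.drop_eq_getElem_cons hlt, ha, List.map_cons, List.sum_cons]
    have htime : time cost s m ((C.B 0).rank O) L (root q : C.Task) =
        time cost s m ((C.B 0).rank O) L (root (q + 1) : C.Task) +
          (104 + nodeTime cost (s * m) L) := by
      simp only [time, hlen]; ring
    rw [hval, htime]
    by_cases ht : (C.B 0).Trivial a.1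
    · have hv : ∀ x y, C.subroutines O g .trivial 0 a.1 x y = (![1, 0, 0, 0], 0) := fun x y => by
        simp [subroutines, hb, ht]
      obtain ⟨τ, t, hrun, htm, hτ⟩ := handle_root_trivial (cost := cost.ofSub) hu hv hσ
      refine ⟨τ, t, [con ⟨0, a⟩ L 0 (O * (C.B 0).op a).trace, root (q + 1)], 0, hrun, ?_, ?_, ?_⟩
      · simpa [enc, h0] using hτ
      · have h1 := time_con_le cost hs hm hr ((C.B 0).rank O) L ⟨0, a⟩ L 0 (O * (C.B 0).op a).trace
        simp only [Costs.ofSub] at htm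
        simp only [List.map_cons, List.map_nil, List.sum_cons, List.sum_nil]
        omega
      · simp only [List.map_cons, List.map_nil, List.sum_cons, List.sum_nil, zero_add, add_zero]
        congr 1
        rw [rootValue, if_pos ht]
        cases L with
        | zero => rw [C.branch_zero hC]; rfl
        | succ L => rw [← C.sum_terms hC]; rfl
    · have hv : ∀ x y, C.subroutines O g .trivial 0 a.1 x y = (![0, 0, 0, 0], 0) := fun x y => by
        simp [subroutines, hb, ht]
      cases L with
      | zero =>
        obtain ⟨τ, t, hrun, htm, hτ⟩ := handle_root_skip (cost := cost.ofSub) hu hv hσ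
        refine ⟨τ, t, [root (q + 1)], 0, hrun, by rw [add_zero]; exact hτ, ?_, ?_⟩
        · simp only [Costs.ofSub] at htm
          simp only [List.map_cons, List.map_nil, List.sum_cons, List.sum_nil]
          omega
        · simp [rootValue, ht]
      | succ L =>
        have hx : ∀ y z, C.subroutines O g .dim 0 a.1 y z = (![(C.B 0).dim a.1, 0, 0, 0], 0) :=
          fun y z => by simp [subroutines, hb]
        obtain ⟨τ, t, hrun, htm, hτ⟩ := handle_root_nontrivial (cost := cost.ofSub) hu hv hx hσ
        refine ⟨τ, t, [mat ⟨0, a⟩ L ((C.B 0).dim a.1) le_rfl (O * (C.B 0).op a).trace, root (q + 1)], 0, hrun,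
          ?_, ?_, ?_⟩
        · simpa [enc, h0] using hτ
        · have h1 := blockTime_mono cost (s * m) L (hm' 0 a.1)
          have h2 := terms_le_nodeTime cost hs hm L
          -- A non-trivial root opens a block without a preceding contraction, so it is cheaper than
          -- the node of height `L + 1` for which it is charged.
          have h3 : blockTime cost (s * m) L m ≤ s * (104 * cost.contract +
              blockTime cost (s * m) L m) :=
            (Nat.le_add_left _ _).trans (Nat.le_mul_of_pos_left _ hs)
          simp only [Costs.ofSub] at htm
          simp only [List.map_cons, List.map_nil, List.sum_cons, List.sum_nil]
          have h4 : time cost s m ((C.B 0).rank O) (L + 1)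
            (mat ⟨0, a⟩ L ((C.B 0).dim a.1) le_rfl (O * (C.B 0).op a).trace) =
              blockTime cost (s * m) L ((C.B 0).dim a.1) := rfl
          omega
        · simp [rootValue, ht, value, fullBranch]

end Task

theorem runs_truncatedMean [NeZero d] [NeZero D] (C : Ensemble G n d D) {γ : ℝ}
    (hC : C.NoisePenalised γ) {s m : ℕ} (hs : 1 ≤ s) (hm : 1 ≤ m)
    (hm' : ∀ i β, (C.B i).dim β ≤ m) (hr : ∀ x, C.contractionRank x ≤ s)
    {O : QOp n d} (hO : O.IsHermitian) (L : ℕ) (cost : Costs) (g : Fin D → G) :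
    ∃ τ t, Runs (C.subroutines O g) cost.ofSub program (State.init L) τ t ∧
      τ.cpx 0 = C.truncatedMean O L g ∧
      t ≤ 416 * ((C.B 0).rank O * (s * m) ^ L * cost.evaluate L + 1) := by
  obtain ⟨τ, t, hrun, hτ, ht⟩ := runs_program (val := C.subroutines O g) (cost := cost.ofSub)
    (Task.enc (C := C) L) (Task.value O L g) (Task.time cost s m ((C.B 0).rank O) L)
    (fun w l σ acc hσ => by
      cases w with
      | root q => exact Task.handle_root hs hm hm' hr hC O L g cost q l σ acc hσ
      | con x ℓ q c => exact Task.handle_con hs hm hm' O L g cost x ℓ q c l σ acc hσ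
      | mat x ℓ q hq c => exact Task.handle_mat hs hm hr hC O L g cost x ℓ q hq c l σ acc hσ)
    L (.root 0) rfl
  refine ⟨τ, t, hrun, ?_, ?_⟩
  · rw [hτ, C.truncatedMean_eq_sum_support hC hO, ← Finset.sum_map_toList]
    rfl
  · refine ht.trans ?_
    have hp : 1 ≤ (s * m) ^ L := Nat.one_le_pow _ _ (Nat.mul_pos hs hm)
    have h1 : 1 ≤ (s * m) ^ L * cost.evaluate L :=
      Nat.mul_pos hp (cost.overlap_pos.trans_le (Nat.le_add_left _ _))
    -- Here 312 = 3 · 104. Adding 104 for the handling of each root gives the constant 416.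
    have h2 : Task.nodeTime cost (s * m) L ≤ 312 * ((s * m) ^ L * cost.evaluate L) := by
      have : L * (3 * cost.contract + cost.matrixCoeff) + cost.overlap ≤ 3 * cost.evaluate L := by
        rw [Costs.evaluate, show 3 * (L * (cost.contract + cost.matrixCoeff) + cost.overlap) =
          L * (3 * cost.contract + cost.matrixCoeff) + cost.overlap +
            (2 * (L * cost.matrixCoeff) + 2 * cost.overlap) by ring]
        exact Nat.le_add_right _ _
      calc Task.nodeTime cost (s * m) L
          ≤ 104 * ((s * m) ^ L * (3 * cost.evaluate L)) :=
            Nat.mul_le_mul_left _ (Nat.mul_le_mul_left _ this)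
        _ = 312 * ((s * m) ^ L * cost.evaluate L) := by ring
    have h3 : (C.B 0).rank O * (104 + Task.nodeTime cost (s * m) L) ≤
        (C.B 0).rank O * (416 * ((s * m) ^ L * cost.evaluate L)) :=
      Nat.mul_le_mul_left _ (by omega)
    have h4 : (C.B 0).rank O * (416 * ((s * m) ^ L * cost.evaluate L)) =
      416 * ((C.B 0).rank O * (s * m) ^ L * cost.evaluate L) := by ring
    simp only [Task.time, Nat.sub_zero]
    omega

end Ensemble

/-! ### Energy of the trajectories of a splitting dynamics -/

/-- The adjoint of a layer splits `A` into `A₀` and `A₁`. If `x` is the part of the norm budget `N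
A` that belongs to the non-trivial branch, the other branch has at most the rest, and the
non-trivial branch retains at most q²·x. Every non-trivial choice thus gains q², and the budgets of
all branches add up to at most that of the root. -/
theorem sum_norm_sq_chain_le {V : Type*} {D : ℕ} (ip : V → V → ℂ) (N : V → ℝ)
    (M : Fin D → Bool → V → V) (ρ : V) {q : ℝ} (hq0 : 0 ≤ q) (hq1 : q ≤ 1)
    (hρ : ∀ A, ‖ip A ρ‖ ^ 2 ≤ N A)
    (hM : ∀ i A, ∃ (A₀ A₁ : V) (x : ℝ), (∀ X, ip A (M i false X) = ip A₀ X) ∧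
      (∀ X, ip A (M i true X) = ip A₁ X) ∧ 0 ≤ x ∧ N A₀ + x ≤ N A ∧ N A₁ ≤ q ^ 2 * x)
    (ℓ : ℕ) (A : V) :
    (∑ S : Fin D → Bool, if ℓ ≤ ∑ i, (S i).toNat then
      ‖ip A ((List.finRange D).foldr (fun i => M i (S i)) ρ)‖ ^ 2 else 0) ≤ (q ^ ℓ) ^ 2 * N A := by
  induction D generalizing ℓ A with
  | zero =>
    have hA : 0 ≤ N A := (sq_nonneg _).trans (hρ A)
    rcases Nat.eq_zero_or_pos ℓ with rfl | hl
    · simpa using hρ A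
    · rw [Finset.sum_eq_zero fun S _ => if_neg (by simpa using hl.ne')]
      positivity
  | succ D ih =>
    obtain ⟨A₀, A₁, x, h0, h1, hx, h2, h3⟩ := hM 0 A
    rw [← (Fin.consEquiv fun _ : Fin (D + 1) => Bool).sum_comp, Fintype.sum_prod_type,
      Fintype.sum_bool]
    have hc : ∀ (b : Bool) (S : Fin D → Bool),
        (Fin.consEquiv fun _ : Fin (D + 1) => Bool) (b, S) = Fin.cons b S := fun _ _ => rfl
    simp only [hc, Fin.sum_univ_succ, Fin.cons_zero, Fin.cons_succ, List.finRange_succ,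
      List.foldr_cons, List.foldr_map, h0, h1, Bool.toNat_true, Bool.toNat_false, zero_add]
    have hf := ih (fun i => M i.succ) (fun i => hM i.succ) ℓ A₀
    have ht := ih (fun i => M i.succ) (fun i => hM i.succ) (ℓ - 1) A₁
    have hiff : ∀ k, ℓ ≤ 1 + k ↔ ℓ - 1 ≤ k := by omega
    simp only [hiff]
    -- For ℓ = 0 the truncated subtraction gains no power, and `q ≤ 1` is what is needed.
    have hq : q ^ (ℓ - 1) * q ≤ q ^ ℓ := by
      rcases Nat.eq_zero_or_pos ℓ with rfl | hl
      · simpa using hq1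
      · rw [← pow_succ, Nat.sub_add_cancel hl]
    have ht' : (q ^ (ℓ - 1)) ^ 2 * N A₁ ≤ (q ^ ℓ) ^ 2 * x :=
      calc (q ^ (ℓ - 1)) ^ 2 * N A₁ ≤ (q ^ (ℓ - 1)) ^ 2 * (q ^ 2 * x) := by gcongr
        _ = (q ^ (ℓ - 1) * q) ^ 2 * x := by ring
        _ ≤ (q ^ ℓ) ^ 2 * x := by gcongr
    calc _ ≤ (q ^ ℓ) ^ 2 * x + (q ^ ℓ) ^ 2 * N A₀ := add_le_add (ht.trans ht') hf
      _ = (q ^ ℓ) ^ 2 * (N A₀ + x) := by ring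
      _ ≤ _ := by gcongr

/-! ### Orthogonal families of functions -/

/-- In the double sum of cross terms only pairs with equal keys survive integration. The sum over
the keys stays inside the integral so that it can be bounded pointwise. -/
theorem integral_norm_sq_sum_of_orthogonal {Ω P κ : Type*} [MeasurableSpace Ω] {μ : Measure Ω}
    [Fintype P] [Fintype κ] [DecidableEq κ] (w : P → Ω → ℂ) (key : P → κ)
    (hi : ∀ p q, Integrable (fun ω => star (w p ω) * w q ω) μ)
    (ho : ∀ p q, key p ≠ key q → ∫ ω, star (w p ω) * w q ω ∂μ = 0) :
    ∫ ω, ‖∑ p, w p ω‖ ^ 2 ∂μ = ∫ ω, ∑ k, ‖∑ p, if key p = k then w p ω else 0‖ ^ 2 ∂μ := by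
  have hsq : ∀ z : ℂ, ((‖z‖ ^ 2 : ℝ) : ℂ) = star z * z := fun z => by
    rw [Complex.star_def, Complex.conj_mul', Complex.ofReal_pow]
  have h1 : ∀ ω, ((‖∑ p, w p ω‖ ^ 2 : ℝ) : ℂ) = ∑ p, ∑ q, star (w p ω) * w q ω := fun ω => by
    rw [hsq, star_sum, Finset.sum_mul_sum]
  have h2 : ∀ ω, ((∑ k, ‖∑ p, if key p = k then w p ω else 0‖ ^ 2 : ℝ) : ℂ) =
      ∑ p, ∑ q, if key p = key q then star (w p ω) * w q ω else 0 := fun ω => by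
    rw [Complex.ofReal_sum]
    simp only [hsq, star_sum, Finset.sum_mul_sum]
    rw [Finset.sum_comm]
    refine Finset.sum_congr rfl fun p _ => ?_
    rw [Finset.sum_comm]
    refine Finset.sum_congr rfl fun q _ => ?_
    rw [Finset.sum_eq_single (key p)]
    · by_cases h : key p = key q
      · simp [h]
      · simp [h, Ne.symm h]
    · intro k _ hk
      simp [hk.symm]
    · simp
  apply Complex.ofReal_injective
  rw [← integral_complex_ofReal, ← integral_complex_ofReal]
  simp only [h1, h2]
  rw [integral_finsetSum _ fun p _ => integrable_finsetSum _ fun q _ => hi p q,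
    integral_finsetSum]
  · refine Finset.sum_congr rfl fun p _ => ?_
    rw [integral_finsetSum _ fun q _ => hi p q, integral_finsetSum]
    · refine Finset.sum_congr rfl fun q _ => ?_
      by_cases h : key p = key q
      · simp [h]
      · simpa [h] using ho p q h
    · intro q _
      split_ifs
      · exact hi p q
      · exact integrable_zero _ _ _
  · intro p _
    refine integrable_finsetSum _ fun q _ => ?_
    split_ifs
    · exact hi p q
    · exact integrable_zero _ _ _

theorem eLpNorm_two_le_of_integral_norm_sq_le {Ω : Type*} [MeasurableSpace Ω] {μ : Measure Ω}
    {f : Ω → ℂ} (hf : MemLp f 2 μ) {c : ℝ} (hc : 0 ≤ c) (h : ∫ ω, ‖f ω‖ ^ 2 ∂μ ≤ c ^ 2) :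
    eLpNorm f 2 μ ≤ ENNReal.ofReal c := by
  rw [hf.eLpNorm_eq_integral_rpow_norm two_ne_zero ENNReal.ofNat_ne_top]
  refine ENNReal.ofReal_le_ofReal ?_
  simp only [ENNReal.toReal_ofNat, Real.rpow_ofNat]
  rw [← one_div, ← Real.sqrt_eq_rpow, Real.sqrt_le_left hc]
  exact h

/-! ### The Hilbert-Schmidt norm in an operator basis -/

section HilbertSchmidt

variable {n d : ℕ}

/-- The square of the Hilbert-Schmidt norm. -/
noncomputable def hsNormSq (A : QOp n d) : ℝ := (hsInner A A).re

theorem hsNormSq_eq (A : QOp n d) : hsNormSq A = ∑ j, ∑ i, ‖A i j‖ ^ 2 := by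
  have : hsInner A A = ((∑ j, ∑ i, ‖A i j‖ ^ 2 : ℝ) : ℂ) := by
    simp only [hsInner, Matrix.trace, Matrix.diag, Matrix.mul_apply, Matrix.conjTranspose_apply,
      Complex.star_def, Complex.conj_mul', Complex.ofReal_sum, Complex.ofReal_pow]
  rw [hsNormSq, this, Complex.ofReal_re]

theorem hsNormSq_nonneg (A : QOp n d) : 0 ≤ hsNormSq A := by
  rw [hsNormSq_eq]; positivity

/-- The input state is a matrix unit, so the overlap is one conjugated entry of `A`. -/
theorem norm_hsInner_zeroState_sq_le [NeZero d] (A : QOp n d) :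
    ‖hsInner A (zeroState n d)‖ ^ 2 ≤ hsNormSq A := by
  have : hsInner A (zeroState n d) = star (A (fun _ => 0) fun _ => 0) := by
    rw [← star_hsInner, hsInner, zeroState, Matrix.conjTranspose_single, star_one,
      Matrix.trace_single_mul, one_smul]
  rw [this, norm_star, hsNormSq_eq]
  calc ‖A (fun _ => 0) fun _ => 0‖ ^ 2 ≤ ∑ i, ‖A i fun _ => 0‖ ^ 2 :=
        Finset.single_le_sum (f := fun i => ‖A i fun _ => 0‖ ^ 2) (fun _ _ => sq_nonneg _)
          (Finset.mem_univ _)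
    _ ≤ _ := Finset.single_le_sum (f := fun j => ∑ i, ‖A i j‖ ^ 2)
          (fun _ _ => Finset.sum_nonneg fun _ _ => sq_nonneg _) (Finset.mem_univ _)

theorem hsNormSq_conj {V : QOp n d} (hV : V * Vᴴ = 1) (A : QOp n d) :
    hsNormSq (Vᴴ * A * V) = hsNormSq A := by
  have : V * (Vᴴ * A * V) * Vᴴ = A := by
    rw [Matrix.mul_assoc, Matrix.mul_assoc, Matrix.mul_assoc, hV, Matrix.mul_one,
      ← Matrix.mul_assoc, hV, Matrix.one_mul]
  rw [hsNormSq, ← hsInner_conj, this, hsNormSq]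

end HilbertSchmidt

namespace ITOBasis

variable {G : Type*} [Group G] {n d : ℕ} {U : G →* Matrix.unitaryGroup (Config n d) ℂ}

theorem hsInner_sum_smul_op (B : ITOBasis U) (c : B.Label → ℂ) (a : B.Label) :
    hsInner (B.op a) (∑ b, c b • B.op b) = c a := by
  simp [hsInner_sum, hsInner_smul, hsInner_op]

theorem hsInner_eq_sum (B : ITOBasis U) (A X : QOp n d) :
    hsInner A X = ∑ a, star (hsInner (B.op a) A) * hsInner (B.op a) X := by
  conv_lhs => rw [← B.sum_hsInner_smul_op X]
  simp only [hsInner_sum, hsInner_smul, star_hsInner, mul_comm]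

theorem hsNormSq_eq_sum (B : ITOBasis U) (A : QOp n d) :
    hsNormSq A = ∑ a, ‖hsInner (B.op a) A‖ ^ 2 := by
  have : hsInner A A = ((∑ a, ‖hsInner (B.op a) A‖ ^ 2 : ℝ) : ℂ) := by
    rw [B.hsInner_eq_sum]
    simp only [Complex.star_def, Complex.conj_mul', Complex.ofReal_sum, Complex.ofReal_pow]
  rw [hsNormSq, this, Complex.ofReal_re]

theorem hsNormSq_sum_smul_op (B : ITOBasis U) (c : B.Label → ℂ) :
    hsNormSq (∑ a, c a • B.op a) = ∑ a, ‖c a‖ ^ 2 := by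
  simp only [B.hsNormSq_eq_sum, hsInner_sum_smul_op]

theorem hsInner_op_conj_op (B : ITOBasis U) (g : G) (a b : B.Label) :
    hsInner (B.op a) ((U g : QOp n d) * B.op b * (U g : QOp n d)ᴴ) =
      ∑ k', if a = ⟨b.1, k'⟩ then B.coeff b.1 g k' b.2 else 0 := by
  have h := B.covariant b.1 b.2 g
  rw [op, op, ← op, h, hsInner_sum]
  refine Finset.sum_congr rfl fun k' _ => ?_
  rw [hsInner_smul, show B.T b.1 k' = B.op ⟨b.1, k'⟩ from rfl, hsInner_op, coeff]
  simp

theorem coeff_eq_hsInner (B : ITOBasis U) (β : Fin B.numBlocks) (g : G) (k k' : Fin (B.dim β)) :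
    B.coeff β g k k' =
      hsInner (B.op ⟨β, k⟩) ((U g : QOp n d) * B.op ⟨β, k'⟩ * (U g : QOp n d)ᴴ) := by
  rw [hsInner_op_conj_op]
  simp

/-- Conjugation by `U g` preserves the blocks, so the component of the conjugated operator at `(β,
k)` involves the block `β` only. This sums out the component with which a path leaves a layer. -/
theorem sum_coeff_mul_hsInner (B : ITOBasis U) (β : Fin B.numBlocks) (g : G) (k : Fin (B.dim β))
    (X : QOp n d) : ∑ k', B.coeff β g k k' * hsInner (B.T β k') X =
      hsInner (B.op ⟨β, k⟩) ((U g : QOp n d) * X * (U g : QOp n d)ᴴ) := by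
  conv_rhs => rw [← B.sum_hsInner_smul_op X]
  simp only [Matrix.mul_sum, Matrix.sum_mul, Matrix.mul_smul, Matrix.smul_mul, hsInner_sum,
    hsInner_smul]
  rw [Fintype.sum_sigma, Finset.sum_eq_single β]
  · refine Finset.sum_congr rfl fun k' _ => ?_
    rw [coeff_eq_hsInner, mul_comm]
    rfl
  · intro β' _ hβ
    refine Finset.sum_eq_zero fun k' _ => ?_
    rw [hsInner_op_conj_op, Finset.sum_eq_zero, mul_zero]
    intro k'' _
    exact if_neg fun h => hβ (congrArg Sigma.fst h).symm
  · simp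

end ITOBasis

namespace ITOBasis

variable {G : Type*} [Group G] {n d : ℕ} {U : G →* Matrix.unitaryGroup (Config n d) ℂ}

/-! ### Matrix coefficients -/

theorem coeff_mul (B : ITOBasis U) (β : Fin B.numBlocks) (g h : G) (k k' : Fin (B.dim β)) :
    B.coeff β (g * h) k k' = ∑ l, B.coeff β g k l * B.coeff β h l k' := by
  rw [coeff, map_mul, Module.End.mul_eq_comp, LinearMap.toMatrix'_comp, Matrix.mul_apply]
  rfl

/-- The fixed vectors form a subrepresentation; by irreducibility it is zero or everything, and in
the latter case the representation is trivial. -/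
theorem eq_zero_of_forall_fixed (B : ITOBasis U) {β : Fin B.numBlocks} (hβ : ¬ B.Trivial β)
    {x : Fin (B.dim β) → ℂ} (hx : ∀ g, B.irrep β g x = x) : x = 0 := by
  let F : Subrepresentation (B.irrep β) :=
    ⟨{ carrier := {y | ∀ g, B.irrep β g y = y}
       add_mem' := fun {y z} hy hz g => by rw [map_add, hy g, hz g]
       zero_mem' := fun g => map_zero _
       smul_mem' := fun c y hy g => by rw [map_smul, hy g] },
      fun g y hy h => by rw [hy g]; exact hy h⟩
  have hmem : ∀ y, y ∈ F ↔ ∀ g, B.irrep β g y = y := fun y => Iff.rfl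
  have := B.irreducible β
  rcases eq_bot_or_eq_top F with h | h
  · have h0 : x ∈ F := hx
    rw [h] at h0
    exact h0
  · refine absurd ⟨fun g => LinearMap.ext fun y => ?_⟩ hβ
    have h0 : y ∈ F := by rw [h]; trivial
    exact h0 g

variable [TopologicalSpace G]

theorem continuous_coeff (B : ITOBasis U) (hU : Continuous fun g => (U g : QOp n d))
    (β : Fin B.numBlocks) (k k' : Fin (B.dim β)) : Continuous fun g => B.coeff β g k k' := by
  simp only [coeff_eq_hsInner, hsInner]
  fun_prop

theorem integrable_of_continuous {G : Type*} [TopologicalSpace G] [CompactSpace G]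
    [MeasurableSpace G] [BorelSpace G] (μ : Measure G) [IsFiniteMeasureOnCompacts μ] {f : G → ℂ} (hf : Continuous f) : Integrable f μ := by
  obtain ⟨c, hc⟩ := isCompact_univ.exists_bound_of_continuousOn hf.continuousOn
  exact Integrable.of_bound hf.measurable.aestronglyMeasurable c
    (Filter.Eventually.of_forall fun g => hc g (Set.mem_univ g))

variable [IsTopologicalGroup G] [CompactSpace G] [MeasurableSpace G] [BorelSpace G]
  (μ : Measure G) [μ.IsHaarMeasure]

/-- By left invariance of Haar measure, a column of integrated coefficients is a vector fixed by the
representation, hence zero. -/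
theorem integral_coeff (B : ITOBasis U) (hU : Continuous fun g => (U g : QOp n d))
    {β : Fin B.numBlocks} (hβ : ¬ B.Trivial β) (k k' : Fin (B.dim β)) :
    ∫ g, B.coeff β g k k' ∂μ = 0 := by
  have hx : (fun l => ∫ g, B.coeff β g l k' ∂μ) = 0 := by
    refine B.eq_zero_of_forall_fixed hβ fun h => ?_
    rw [← LinearMap.toMatrix'_mulVec]
    funext l
    rw [Matrix.mulVec, dotProduct, ← integral_mul_left_eq_self _ h]
    simp only [coeff_mul]
    rw [integral_finsetSum _ fun i _ =>
      (integrable_of_continuous μ (B.continuous_coeff hU β i k')).const_mul _]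
    refine Finset.sum_congr rfl fun i _ => ?_
    rw [integral_const_mul]
    rfl
  exact congrFun hx k

end ITOBasis

/-! ### Path sums sorted by their non-trivial layers -/

namespace Ensemble

variable {G : Type*} [Group G] [TopologicalSpace G] {n d D : ℕ}

/-- The unitary of a layer. -/
noncomputable def layerUnitary (C : Ensemble G n d D) (g : Fin D → G) (i : Fin D) : QOp n d :=
  (C.U i (g i) : QOp n d) * (C.W i : QOp n d)

theorem layerUnitary_mul_conjTranspose (C : Ensemble G n d D) (g : Fin D → G) (i : Fin D) :
    C.layerUnitary g i * (C.layerUnitary g i)ᴴ = 1 := by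
  have hW : (C.W i : QOp n d) * (C.W i : QOp n d)ᴴ = 1 := Matrix.mem_unitaryGroup_iff.1 (C.W i).2
  have hU : (C.U i (g i) : QOp n d) * (C.U i (g i) : QOp n d)ᴴ = 1 :=
    Matrix.mem_unitaryGroup_iff.1 (C.U i (g i)).2
  rw [layerUnitary, Matrix.conjTranspose_mul, Matrix.mul_assoc, ← Matrix.mul_assoc _ _ (_)ᴴ, hW,
    Matrix.one_mul, hU]

open Classical in
/-- The part of a noisy layer on the trivial or on the non-trivial basis operators. -/
noncomputable def layerPart (C : Ensemble G n d D) (g : Fin D → G) (i : Fin D) (b : Bool)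
    (X : QOp n d) : QOp n d :=
  ∑ a : (C.B i).Label, (if b = !decide ((C.B i).Trivial a.1) then C.noiseEigenvalue i a *
    hsInner ((C.B i).op a) (C.layerUnitary g i * X * (C.layerUnitary g i)ᴴ) else 0) • (C.B i).op a

theorem sum_stepFunctional_smul (C : Ensemble G n d D) (g : Fin D → G) (i : Fin D)
    (P : Fin (C.B i).numBlocks → Prop) [DecidablePred P] (X : QOp n d) :
    ∑ x : C.Step i, (if P x.1 then C.stepFunctional g i x else 0) X • (C.B i).T x.1 x.2.1 =
      ∑ a : (C.B i).Label, (if P a.1 then C.noiseEigenvalue i a *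
        hsInner ((C.B i).op a) (C.layerUnitary g i * X * (C.layerUnitary g i)ᴴ) else 0) •
          (C.B i).op a := by
  rw [Fintype.sum_sigma, Fintype.sum_sigma]
  refine Finset.sum_congr rfl fun β _ => ?_
  rw [Fintype.sum_prod_type]
  refine Finset.sum_congr rfl fun k _ => ?_
  change ∑ k', (if P β then C.stepFunctional g i ⟨β, k, k'⟩ else 0) X • (C.B i).T β k = _
  rw [← Finset.sum_smul]
  by_cases h : P β
  · simp only [h, if_true, stepFunctional_apply, matCoeff, mul_assoc]
    rw [← Finset.mul_sum, ITOBasis.sum_coeff_mul_hsInner, conjW_apply, layerUnitary,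
      Matrix.conjTranspose_mul]
    simp only [Matrix.mul_assoc]
    rfl
  · simp [h]

open Classical in
/-- The non-trivial layers of a path. -/
noncomputable def pattern (C : Ensemble G n d D) (p : C.Path) (i : Fin D) : Bool :=
  !decide ((C.B i).Trivial (p i).1)

theorem pathDegree_eq_sum_pattern (C : Ensemble G n d D) (p : C.Path) :
    C.pathDegree p = ∑ i, (C.pattern p i).toNat := by
  classical
  rw [pathDegree_eq]
  refine Finset.sum_congr rfl fun i _ => ?_
  by_cases h : (C.B i).Trivial (p i).1 <;> simp [weight, pattern, h]

/-- Replacing the step functional by zero wherever the block disagrees with `S` kills exactly the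
paths with another pattern, while the sum remains a transfer product, now of the partial layers. -/
theorem sum_pathWeight_of_pattern [NeZero d] (C : Ensemble G n d D) (O : QOp n d) (g : Fin D → G)
    (S : Fin D → Bool) : (∑ p : C.Path, if C.pattern p = S then C.pathWeight O p g else 0) =
      obs O ((List.finRange D).foldr (fun i => C.layerPart g i (S i)) (zeroState n d)) := by
  classical
  have h := sum_paths (α := C.Step) (fun i x => (C.B i).T x.1 x.2.1)
    (fun i x => if S i = !decide ((C.B i).Trivial x.1) then C.stepFunctional g i x else 0)
    (zeroState n d) (obs O)
  have e : (fun i u => ∑ x : C.Step i, (if S i = !decide ((C.B i).Trivial x.1) then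
      C.stepFunctional g i x else 0) u • (C.B i).T x.1 x.2.1) =
      fun i => C.layerPart g i (S i) := by
    funext i u
    exact C.sum_stepFunctional_smul g i (fun β => S i = !decide ((C.B i).Trivial β)) u
  rw [e] at h
  rw [← h]
  refine Finset.sum_congr rfl fun p _ => ?_
  rw [pathWeight_eq]
  by_cases hp : C.pattern p = S
  · rw [if_pos hp]
    congr 1
    refine Finset.prod_congr rfl fun i _ => ?_
    rw [if_pos (show S i = !decide ((C.B i).Trivial (p i).1) from (congrFun hp i).symm)]
  · rw [if_neg hp]
    obtain ⟨i, hi⟩ := Function.ne_iff.1 hp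
    rw [Finset.prod_eq_zero (Finset.mem_univ i), mul_zero]
    rw [if_neg (show ¬ S i = !decide ((C.B i).Trivial (p i).1) from Ne.symm hi),
      LinearMap.zero_apply]

theorem noisyMean_eq_sum_pathWeight [NeZero d] (C : Ensemble G n d D) {γ : ℝ}
    (hC : C.NoisePenalised γ) (O : QOp n d) (g : Fin D → G) :
    C.noisyMean O g = ∑ p : C.Path, C.pathWeight O p g := by
  classical
  have h := sum_paths (α := C.Step) (fun i x => (C.B i).T x.1 x.2.1) (C.stepFunctional g)
    (zeroState n d) (obs O)
  simp only [pathWeight_eq]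
  rw [h, noisyMean, noisyState, ← obs_apply]
  congr 2
  funext i X
  have h1 := C.sum_stepFunctional_smul g i (fun _ => True) X
  simp only [if_true] at h1
  rw [h1]
  change C.E i (C.layerUnitary g i * X * (C.layerUnitary g i)ᴴ) = _
  conv_lhs => rw [← (C.B i).sum_hsInner_smul_op (C.layerUnitary g i * X * (C.layerUnitary g i)ᴴ)]
  rw [map_sum]
  refine Finset.sum_congr rfl fun a _ => ?_
  rw [map_smul, hC.diagonal, smul_smul, mul_comm]

/-! ### The energy of the paths with many non-trivial layers -/

/-- The noise is diagonal in an orthonormal basis, so its adjoint multiplies the coefficients of `A`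
by conjugate eigenvalues, and undoing the unitary layer keeps the norm. The witness `x` is the
energy of the non-trivial components of `A`. -/
theorem layerPart_adjoint (C : Ensemble G n d D) {γ : ℝ} (hC : C.NoisePenalised γ) (g : Fin D → G)
    (i : Fin D) (A : QOp n d) : ∃ (A₀ A₁ : QOp n d) (x : ℝ),
      (∀ X, hsInner A (C.layerPart g i false X) = hsInner A₀ X) ∧
      (∀ X, hsInner A (C.layerPart g i true X) = hsInner A₁ X) ∧ 0 ≤ x ∧
      hsNormSq A₀ + x ≤ hsNormSq A ∧ hsNormSq A₁ ≤ Real.exp (-γ) ^ 2 * x := by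
  classical
  let c : Bool → (C.B i).Label → ℂ := fun b a => if b = !decide ((C.B i).Trivial a.1) then
    star (C.noiseEigenvalue i a) * hsInner ((C.B i).op a) A else 0
  let R : Bool → QOp n d := fun b =>
    (C.layerUnitary g i)ᴴ * (∑ a, c b a • (C.B i).op a) * C.layerUnitary g i
  have hR : ∀ b X, hsInner A (C.layerPart g i b X) = hsInner (R b) X := by
    intro b X
    rw [← hsInner_conj, (C.B i).hsInner_eq_sum, (C.B i).hsInner_eq_sum (∑ a, c b a • _)]
    refine Finset.sum_congr rfl fun a _ => ?_
    rw [layerPart, ITOBasis.hsInner_sum_smul_op, ITOBasis.hsInner_sum_smul_op]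
    by_cases h : b = !decide ((C.B i).Trivial a.1)
    · simp only [c, if_pos h, star_mul', star_star]; ring
    · simp only [c, if_neg h, star_zero, mul_zero, zero_mul]
  have hN : ∀ b, hsNormSq (R b) = ∑ a, ‖c b a‖ ^ 2 := fun b => by
    rw [hsNormSq_conj (C.layerUnitary_mul_conjTranspose g i), ITOBasis.hsNormSq_sum_smul_op]
  refine ⟨R false, R true, ∑ a : (C.B i).Label, if (C.B i).Trivial a.1 then 0 else
    ‖hsInner ((C.B i).op a) A‖ ^ 2, hR false, hR true, ?_, ?_, ?_⟩
  · refine Finset.sum_nonneg fun a _ => ?_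
    split_ifs
    · exact le_rfl
    · positivity
  · rw [hN, (C.B i).hsNormSq_eq_sum, ← Finset.sum_add_distrib]
    refine Finset.sum_le_sum fun a _ => ?_
    by_cases h : (C.B i).Trivial a.1
    · simp [c, h, hC.fixes_trivial i a h]
    · simp [c, h]
  · rw [hN, Finset.mul_sum]
    refine Finset.sum_le_sum fun a _ => ?_
    by_cases h : (C.B i).Trivial a.1
    · simp [c, h]
    · simp only [c, h, decide_false, Bool.not_false, if_true, if_false, norm_mul, norm_star, mul_pow]
      -- This is 1 - γ ≤ exp(-γ).
      have h1 : ‖C.noiseEigenvalue i a‖ ≤ Real.exp (-γ) :=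
        (hC.gap i a h).trans (by linarith [Real.add_one_le_exp (-γ)])
      gcongr

theorem sum_norm_sq_patterns_le [NeZero d] (C : Ensemble G n d D) {γ : ℝ} (hC : C.NoisePenalised γ)
    {O : QOp n d} (hO : O.IsHermitian) (L : ℕ) (g : Fin D → G) :
    (∑ S : Fin D → Bool, if L ≤ ∑ i, (S i).toNat then
      ‖∑ p : C.Path, if C.pattern p = S then C.pathWeight O p g else 0‖ ^ 2 else 0) ≤
      (Real.exp (-(γ * L)) * hsNorm O) ^ 2 := by
  have h := sum_norm_sq_chain_le hsInner hsNormSq (C.layerPart g) (zeroState n d)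
    (Real.exp_pos (-γ)).le (Real.exp_le_one_iff.2 (neg_nonpos.2 hC.gap_nonneg))
    norm_hsInner_zeroState_sq_le (C.layerPart_adjoint hC g) L O
  have e : (Real.exp (-(γ * L)) * hsNorm O) ^ 2 = (Real.exp (-γ) ^ L) ^ 2 * hsNormSq O := by
    have : hsNorm O ^ 2 = hsNormSq O := Real.sq_sqrt (hsNormSq_nonneg O)
    have hexp : Real.exp (-γ) ^ L = Real.exp (-(γ * L)) := by
      rw [← Real.exp_nat_mul]
      congr 1
      ring
    rw [mul_pow, this, hexp]
  rw [e]
  simpa only [sum_pathWeight_of_pattern, obs_apply, hsInner_of_isHermitian hO] using h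

/-! ### Integration over the group -/

section Haar

/-- The part of the weight of a path that does not depend on the group elements. -/
noncomputable def pathConst [NeZero d] (C : Ensemble G n d D) (O : QOp n d) (p : C.Path) : ℂ :=
  (O * C.pathKet p 0).trace * ∏ i : Fin D, (C.noiseEigenvalue i ⟨(p i).1, (p i).2.1⟩ *
    hsInner ((C.B i).T (p i).1 (p i).2.2)
      ((C.W i : QOp n d) * C.pathKet p (i + 1) * (C.W i : QOp n d)ᴴ))

/-- The matrix coefficient at a layer of a path. -/
noncomputable def pathCoeff (C : Ensemble G n d D) (p : C.Path) (i : Fin D) (g : G) : ℂ :=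
  (C.B i).coeff (p i).1 g (p i).2.1 (p i).2.2

theorem pathWeight_eq_const_mul [NeZero d] (C : Ensemble G n d D) (O : QOp n d) (p : C.Path)
    (g : Fin D → G) :
    C.pathWeight O p g = C.pathConst O p * ∏ i, C.pathCoeff p i (g i) := by
  rw [pathWeight, pathConst, mul_assoc, ← Finset.prod_mul_distrib]
  congr 1
  refine Finset.prod_congr rfl fun i _ => ?_
  rw [pathCoeff]; ring

theorem continuous_pathCoeff (C : Ensemble G n d D) (p : C.Path) (i : Fin D) :
    Continuous (C.pathCoeff p i) :=
  (C.B i).continuous_coeff (C.continuous_U i) _ _ _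

/-- Measurability is checked factor by factor, since without second countability the product
σ-algebra on G^D may be smaller than the Borel σ-algebra. -/
theorem measurable_pathWeight [MeasurableSpace G] [BorelSpace G] [NeZero d] (C : Ensemble G n d D) (O : QOp n d) (p : C.Path) :
    Measurable (C.pathWeight O p) := by
  have : C.pathWeight O p = fun g => C.pathConst O p * ∏ i, C.pathCoeff p i (g i) :=
    funext fun g => C.pathWeight_eq_const_mul O p g
  rw [this]
  refine (Finset.measurable_fun_prod _ fun i _ => ?_).const_mul _
  exact (C.continuous_pathCoeff p i).measurable.comp (measurable_pi_apply i)

theorem star_pathWeight_mul [NeZero d] (C : Ensemble G n d D) (O : QOp n d) (p q : C.Path)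
    (g : Fin D → G) : star (C.pathWeight O p g) * C.pathWeight O q g =
      (star (C.pathConst O p) * C.pathConst O q) *
        ∏ i, (star (C.pathCoeff p i (g i)) * C.pathCoeff q i (g i)) := by
  rw [pathWeight_eq_const_mul, pathWeight_eq_const_mul, star_mul', star_prod,
    Finset.prod_mul_distrib]
  ring

variable [CompactSpace G] [MeasurableSpace G] [BorelSpace G] (μ : Measure G) [μ.IsHaarMeasure]

theorem integrable_star_pathWeight_mul [NeZero d] (C : Ensemble G n d D) (O : QOp n d)
    (p q : C.Path) : Integrable (fun g => star (C.pathWeight O p g) * C.pathWeight O q g)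
      (Measure.pi fun _ : Fin D => μ) := by
  simp only [star_pathWeight_mul]
  refine Integrable.const_mul ?_ _
  exact Integrable.fintype_prod (f := fun i g => star (C.pathCoeff p i g) * C.pathCoeff q i g)
    fun i => ITOBasis.integrable_of_continuous μ
      ((C.continuous_pathCoeff p i).star.mul (C.continuous_pathCoeff q i))

variable [IsTopologicalGroup G]

/-- The integral factorises over the layers. At a layer where the patterns differ, one coefficient
is constant and the other integrates to zero. -/
theorem integral_star_pathWeight_mul [NeZero d] (C : Ensemble G n d D) (O : QOp n d)
    (p q : C.Path) (h : C.pattern p ≠ C.pattern q) :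
    ∫ g, star (C.pathWeight O p g) * C.pathWeight O q g ∂(Measure.pi fun _ : Fin D => μ) = 0 := by
  classical
  simp only [star_pathWeight_mul]
  rw [integral_const_mul, integral_fintype_prod_eq_prod
    (fun i g => star (C.pathCoeff p i g) * C.pathCoeff q i g)]
  obtain ⟨i, hi⟩ := Function.ne_iff.1 h
  rw [Finset.prod_eq_zero (Finset.mem_univ i), mul_zero]
  by_cases hp : (C.B i).Trivial (p i).1
  · have hq : ¬ (C.B i).Trivial (q i).1 := fun hq => hi (by simp [pattern, hp, hq])
    simp only [pathCoeff, ITOBasis.coeff_of_trivial _ hp]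
    rw [integral_const_mul, (C.B i).integral_coeff μ (C.continuous_U i) hq, mul_zero]
  · have hq : (C.B i).Trivial (q i).1 := by
      by_contra hq
      exact hi (by simp [pattern, hp, hq])
    simp only [pathCoeff, ITOBasis.coeff_of_trivial _ hq]
    rw [integral_mul_const]
    have := (C.B i).integral_coeff μ (C.continuous_U i) hp (p i).2.1 (p i).2.2
    simp only [Complex.star_def]
    rw [integral_conj, this, map_zero, zero_mul]

theorem eLpNorm_noisyMean_sub_truncatedMean_le [IsProbabilityMeasure μ] [NeZero d]
    (C : Ensemble G n d D) {γ : ℝ} (hC : C.NoisePenalised γ) {O : QOp n d} (hO : O.IsHermitian)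
    (L : ℕ) : eLpNorm (fun g => C.noisyMean O g - C.truncatedMean O L g) 2
        (Measure.pi fun _ : Fin D => μ) ≤
      ENNReal.ofReal (Real.exp (-(γ * L)) * hsNorm O) := by
  classical
  let w : C.Path → (Fin D → G) → ℂ := fun p g =>
    if L < C.pathDegree p then C.pathWeight O p g else 0
  have hF : (fun g => C.noisyMean O g - C.truncatedMean O L g) = fun g => ∑ p, w p g := by
    funext g
    rw [C.noisyMean_eq_sum_pathWeight hC, truncatedMean, ← Finset.sum_sub_distrib]
    refine Finset.sum_congr rfl fun p _ => ?_
    by_cases h : C.pathDegree p ≤ L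
    · simp [w, h, Nat.not_lt.2 h]
    · simp [w, h, Nat.not_le.1 h]
  have hi : ∀ p q, Integrable (fun g => star (w p g) * w q g) (Measure.pi fun _ : Fin D => μ) := by
    intro p q
    by_cases hp : L < C.pathDegree p
    · by_cases hq : L < C.pathDegree q
      · simpa only [w, if_pos hp, if_pos hq] using C.integrable_star_pathWeight_mul μ O p q
      · simp [w, hq]
    · simp [w, hp]
  have ho : ∀ p q, C.pattern p ≠ C.pattern q →
      ∫ g, star (w p g) * w q g ∂(Measure.pi fun _ : Fin D => μ) = 0 := by
    intro p q hpq
    by_cases hp : L < C.pathDegree p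
    · by_cases hq : L < C.pathDegree q
      · simpa only [w, if_pos hp, if_pos hq] using C.integral_star_pathWeight_mul μ O p q hpq
      · simp [w, hq]
    · simp [w, hp]
  have hm : ∀ p, MemLp (w p) 2 (Measure.pi fun _ : Fin D => μ) := by
    intro p
    by_cases hp : L < C.pathDegree p
    · have e : w p = C.pathWeight O p := funext fun g => if_pos hp
      rw [e, memLp_two_iff_integrable_sq_norm (C.measurable_pathWeight O p).aestronglyMeasurable]
      have := (C.integrable_star_pathWeight_mul μ O p p).norm
      simpa only [norm_mul, norm_star, ← sq] using this
    · have e : w p = 0 := funext fun g => if_neg hp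
      rw [e]
      exact MemLp.zero
  rw [hF]
  refine eLpNorm_two_le_of_integral_norm_sq_le (memLp_finsetSum _ fun p _ => hm p)
    (mul_nonneg (Real.exp_pos _).le (Real.sqrt_nonneg _)) ?_
  rw [integral_norm_sq_sum_of_orthogonal w C.pattern hi ho]
  -- The error only contains patterns of degree greater than `L`, while the energy bound counts
  -- those of degree at least `L`; the patterns of degree exactly `L` contribute zero on the left.
  have hb : ∀ g, ∑ S, ‖∑ p, if C.pattern p = S then w p g else 0‖ ^ 2 ≤
      (Real.exp (-(γ * L)) * hsNorm O) ^ 2 := by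
    intro g
    refine le_trans (Finset.sum_le_sum fun S _ => ?_) (C.sum_norm_sq_patterns_le hC hO L g)
    split_ifs with hS
    · by_cases hS' : L < ∑ i, (S i).toNat
      · refine le_of_eq (congrArg (fun z : ℂ => ‖z‖ ^ 2) (Finset.sum_congr rfl fun p _ => ?_))
        by_cases hp : C.pattern p = S
        · have : L < C.pathDegree p := by rw [pathDegree_eq_sum_pattern, hp]; exact hS'
          simp [w, hp, this]
        · simp [hp]
      · rw [Finset.sum_eq_zero, norm_zero, zero_pow two_ne_zero]
        · exact sq_nonneg _
        · intro p _
          by_cases hp : C.pattern p = S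
          · have : ¬ L < C.pathDegree p := by rw [pathDegree_eq_sum_pattern, hp]; exact hS'
            simp [w, this]
          · simp [hp]
    · rw [Finset.sum_eq_zero, norm_zero]
      · simp
      · intro p _
        by_cases hp : C.pattern p = S
        · have : ¬ L < C.pathDegree p := by
            rw [pathDegree_eq_sum_pattern, hp]; exact fun h => hS h.le
          simp [w, this]
        · simp [hp]
  calc _ ≤ ∫ _, (Real.exp (-(γ * L)) * hsNorm O) ^ 2 ∂(Measure.pi fun _ : Fin D => μ) :=
        integral_mono_of_nonneg (Filter.Eventually.of_forall fun g => by positivity)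
          (integrable_const _) (Filter.Eventually.of_forall hb)
    _ = _ := by simp

end Haar

end Ensemble

end GroupCircuit

/-! ### The main theorem -/

theorem theorem1 :
    ∃ (A : GroupCircuit.Program) (K : ℕ),
      ∀ {G : Type*} [Group G] [TopologicalSpace G] [IsTopologicalGroup G] [CompactSpace G]
        [MeasurableSpace G] [BorelSpace G]
        (μ : MeasureTheory.Measure G) [μ.IsHaarMeasure] [MeasureTheory.IsProbabilityMeasure μ]
        (n d D : ℕ) [NeZero d] [NeZero D]
        (C : GroupCircuit.Ensemble G n d D)
        (γ : ℝ) (_ : C.NoisePenalised γ)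
        (s : ℕ) (_ : C.ControlledGrowth s)
        (dmax : ℕ) (_ : ∀ i β, (C.B i).dim β ≤ dmax)
        (O : GroupCircuit.QOp n d) (_ : O.IsHermitian) (L : ℕ),
        MeasureTheory.eLpNorm (fun g => C.noisyMean O g - C.truncatedMean O L g) 2
            (MeasureTheory.Measure.pi fun _ : Fin D => μ) ≤
          ENNReal.ofReal (Real.exp (-(γ * L)) * GroupCircuit.hsNorm O) ∧
        ∀ (cost : GroupCircuit.Costs) (g : Fin D → G),
          ∃ (τ : GroupCircuit.State) (t : ℕ),
            GroupCircuit.Runs (C.subroutines O g) cost.ofSub A (GroupCircuit.State.init L) τ t ∧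
            τ.cpx 0 = C.truncatedMean O L g ∧
            t ≤ K * ((C.B 0).rank O * (s * dmax) ^ L * cost.evaluate L + 1) := by
  refine ⟨GroupCircuit.program, 416, ?_⟩
  intro G _ _ _ _ _ _ μ _ _ n d D _ _ C γ hC s hs m hm O hO L
  refine ⟨C.eLpNorm_noisyMean_sub_truncatedMean_le μ hC hO L, fun cost g => ?_⟩
  -- The time analysis needs `s` and `m` positive, so both are first raised to at least one. If `O`
  -- has an empty expansion, the product in the bound vanishes for any values; otherwise a basis
  -- operator in the support shows that both were positive already.
  obtain ⟨τ, t, hrun, hτ, ht⟩ := C.runs_truncatedMean hC (le_max_right s 1) (le_max_right m 1)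
    (fun i β => (hm i β).trans (le_max_left m 1)) (fun x => (hs.rank_le x).trans (le_max_left s 1))
    hO L cost g
  refine ⟨τ, t, hrun, hτ, ?_⟩
  rcases Nat.eq_zero_or_pos ((C.B 0).rank O) with h0 | h0
  · simpa [h0] using ht
  · obtain ⟨a, -⟩ := Finset.card_pos.1 h0
    have hs1 : 1 ≤ s := (C.one_le_contractionRank ⟨0, a⟩).trans (hs.rank_le _)
    have hm1 : 1 ≤ m := (Nat.succ_le_of_lt (Nat.zero_lt_of_lt a.2.2)).trans (hm 0 a.1)
    rwa [max_eq_left hs1, max_eq_left hm1] at ht
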